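/- Let $\beta>0$, let $\mathcal H$ be a $d$-dimensional Hilbert space with Hamiltonian $H=\sum_{i=1}^d E_i|i\rangle\langle i|$, and let $\tau=e^{-\beta H}/\operatorname{Tr}e^{-\beta H}$. Assume that $H$ is not a multiple of the identity (or that $d=1$). Write $\mathcal D(\cdot)$ for the set of density operators on a Hilbert space. On $\mathcal H^{\otimes n}$ the Hamiltonian is $H^{\times n}=\sum_{j=1}^n I^{\otimes(j-1)}\otimes H\otimes I^{\otimes(n-j)}$. The work storage is the Hilbert space $\mathcal H_W$ with orthonormal basis $\{|W\rangle: W\in\mathbb W\}$ and Hamiltonian $H_W=\sum_{W\in\mathbb W}W|W\rangle\langle W|$, where $$\mathbb W=\Big\{\sum_{i=1}^d N_iE_i\ge 0 \;:\; N_i\in\mathbb Z,\ \sum_{i=1}^d N_i=0\Big\}.$$ A map $\Lambda:\mathcal D(\mathcal H_A)\to\mathcal D(\mathcal H_B)$ is a thermal operation if there are a bath $E$ with Hamiltonian $H_E$, $\operatorname{Tr}e^{-\beta H_E}<\infty$, and Gibbs state $\tau_E=e^{-\beta H_E}/\operatorname{Tr}e^{-\beta H_E}$, a decomposition of the composite system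 $A+E$ into $B$ and a remainder (with additive Hamiltonians), and a unitary $U$ on $A+E$ with $[U,H_A\otimes I+I\otimes H_E]=0$, such that $\Lambda(\rho)=\operatorname{Tr}_{A+E-B}[U(\rho\otimes\tau_E)U^\dagger]$ for all $\rho\in\mathcal D(\mathcal H_A)$. For a thermal operation $\Lambda:\mathcal D(\mathcal H^{\otimes n}\otimes\mathcal H_W)\to\mathcal D(\mathcal H_W)$, a state $\rho\in\mathcal D(\mathcal H)$ and $\varepsilon>0$, put $$W^\varepsilon(\rho^{\otimes n},\Lambda)=\max\big\{W\in\mathbb W : \langle W|\,\Lambda(\rho^{\otimes n}\otimes|0\rangle\langle 0|)\,|W\rangle\ge 1-\varepsilon\big\}$$ (and $-\infty$ if there is no such $W$). Then there is a single sequence of thermal operations $\Lambda_n:\mathcal D(\mathcal H^{\otimes n}\otimes\mathcal H_W)\to\mathcal D(\mathcal H_W)$, $n\in\mathbb N$, not depending on $\rho$, such that for every state $\rho\in\mathcal D(\mathcal H)$ $$\beta\,\lim_{\varepsilon\to+0}\ \limsup_{n\to\infty}\ \frac1n\,W^\varepsilon(\rho^{\otimes n},\Lambda_n)=D(\rho\|\tau),\qquad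 D(\rho\|\tau)=\operatorname{Tr}[\rho\log\rho-\rho\log\tau].$$ -/

import Mathlib

/-!
Quantum systems are described in an orthonormal basis of energy eigenvectors.  A system is an index
type `ι` (labelling the eigenvectors `|i⟩`) together with its energy levels `E : ι → ℝ`; its Hilbert
space is `ℓ²(ι)` and its Hamiltonian is `H = ∑ i, E i |i⟩⟨i|`.  Operators are given by their matrix
elements `⟨i|X|j⟩`; nothing forces a state to be diagonal.  The index type may be infinite: sums over
an infinite index type below converge absolutely for the density matrices and unitaries to which they
are applied.
-/

open Filter Topology
open scoped Kronecker ComplexOrder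

noncomputable section

namespace Thermo

/-- Density operators on `ℓ²(ι)`, by their matrix elements: positive semidefinite, of trace one. -/
def IsDensity {ι : Type*} (ρ : Matrix ι ι ℂ) : Prop :=
  ρ.PosSemidef ∧ HasSum (fun i => ρ i i) 1

/-- Unitary operators on `ℓ²(ι)`, by their matrix elements: `U† U = 1` and `U U† = 1`. -/
def IsUnitary {ι : Type*} (U : Matrix ι ι ℂ) : Prop :=
  (∀ i, HasSum (fun k => star (U k i) * U k i) 1) ∧
  (∀ i j, i ≠ j → HasSum (fun k => star (U k i) * U k j) 0) ∧
  (∀ i, HasSum (fun k => U i k * star (U i k)) 1) ∧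
  (∀ i j, i ≠ j → HasSum (fun k => U i k * star (U j k)) 0)

/-- The matrix of `U X U†`. -/
def conjBy {ι : Type*} (U X : Matrix ι ι ℂ) : Matrix ι ι ℂ :=
  fun i j => ∑' p : ι × ι, U i p.1 * X p.1 p.2 * star (U j p.2)

/-- `[U, H] = 0` for `H = ∑ i, E i |i⟩⟨i|`, read as `⟨i|H U|j⟩ = ⟨i|U H|j⟩`. -/
def ConservesEnergy {ι : Type*} (E : ι → ℝ) (U : Matrix ι ι ℂ) : Prop :=
  ∀ i j, (E i : ℂ) * U i j = U i j * (E j : ℂ)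

/-- The partial trace over the second factor. -/
def partialTrace {b f : Type*} (X : Matrix (b × f) (b × f) ℂ) : Matrix b b ℂ :=
  fun i j => ∑' k : f, X (i, k) (j, k)

/-- Energy levels of two systems without interaction: `H_A ⊗ I + I ⊗ H_B`. -/
def addEnergy {a b : Type*} (EA : a → ℝ) (EB : b → ℝ) : a × b → ℝ :=
  fun p => EA p.1 + EB p.2

/-- The partition function `Tr e^{-βH}`. -/
def partitionFn {ι : Type*} (β : ℝ) (E : ι → ℝ) : ℝ :=
  ∑' i, Real.exp (-β * E i)

open Classical in
/-- The Gibbs state `e^{-βH} / Tr e^{-βH}`. -/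
def gibbs {ι : Type*} (β : ℝ) (E : ι → ℝ) : Matrix ι ι ℂ :=
  Matrix.diagonal fun i => ((Real.exp (-β * E i) / partitionFn β E : ℝ) : ℂ)

/-- `Λ` is a thermal operation from the system `(a, EA)` to the system `(b, EB)` at inverse
temperature `β`: there are a bath `(κ, EK)` with finite partition function, a decomposition of the
noninteracting composite of input and bath into the output system and a remainder `(r, ER)`, and a
unitary `U` of this composite commuting with its total Hamiltonian, such that on every state `ρ`,
`Λ ρ` is obtained by attaching the Gibbs state of the bath, applying `U`, and tracing out the
remainder. -/
def IsThermalOperation {a b : Type} (β : ℝ) (EA : a → ℝ) (EB : b → ℝ)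
    (Λ : Matrix a a ℂ → Matrix b b ℂ) : Prop :=
  ∃ (κ r : Type) (EK : κ → ℝ) (ER : r → ℝ) (e : a × κ ≃ b × r)
    (U : Matrix (a × κ) (a × κ) ℂ),
    Summable (fun k => Real.exp (-β * EK k)) ∧
    (∀ x, addEnergy EB ER (e x) = addEnergy EA EK x) ∧
    IsUnitary U ∧
    ConservesEnergy (addEnergy EA EK) U ∧
    ∀ ρ : Matrix a a ℂ, IsDensity ρ →
      Λ ρ = partialTrace ((conjBy U (ρ ⊗ₖ gibbs β EK)).submatrix e.symm e.symm)

/-- Energy levels of `n` noninteracting copies of a system. -/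
def copiesEnergy {ι : Type*} (E : ι → ℝ) (n : ℕ) : (Fin n → ι) → ℝ :=
  fun s => ∑ i, E (s i)

/-- The matrix of `ρ^{⊗ n}`. -/
def tensorPower {ι : Type*} (ρ : Matrix ι ι ℂ) (n : ℕ) : Matrix (Fin n → ι) (Fin n → ι) ℂ :=
  fun s t => ∏ i, ρ (s i) (t i)

/-- The energy levels of the work storage: all `∑ i, N i * E i ≥ 0` with `N i ∈ ℤ`, `∑ i, N i = 0`. -/
def workSet {d : ℕ} (E : Fin d → ℝ) : Set ℝ :=
  {W | 0 ≤ W ∧ ∃ N : Fin d → ℤ, ∑ i, N i = 0 ∧ W = ∑ i, (N i : ℝ) * E i}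

/-- Energy levels of the work storage, whose Hamiltonian is `∑ W ∈ workSet E, W |W⟩⟨W|`. -/
def workEnergy {d : ℕ} (E : Fin d → ℝ) : workSet E → ℝ := fun W => W

/-- The label of the ground state `|0⟩` of the work storage. -/
def workGround {d : ℕ} (E : Fin d → ℝ) : workSet E := ⟨0, le_refl 0, 0, by simp, by simp⟩

open Classical in
/-- The projector `|i⟩⟨i|`. -/
def basisProj {ι : Type*} (i : ι) : Matrix ι ι ℂ := Matrix.single i i 1

/-- The fidelity `F(σ, |i⟩⟨i|) = ⟨i|σ|i⟩` of a state `σ` with the pure state `|i⟩⟨i|`. -/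
def fidelityBasis {ι : Type*} (σ : Matrix ι ι ℂ) (i : ι) : ℝ := (σ i i).re

/-- The work `max {W ∈ workSet E | F(Λ(ρ^{⊗ n} ⊗ |0⟩⟨0|), |W⟩⟨W|) ≥ 1 - ε}` extracted by `Λ` from
`ρ^{⊗ n}` with error `ε`, with value `-∞` if there is no such `W`.  For `ε < 1` the set is finite,
because the fidelities of a state with the various `|W⟩⟨W|` add up to one. -/
def extractedWork {d : ℕ} (E : Fin d → ℝ) (n : ℕ)
    (Λ : Matrix ((Fin n → Fin d) × workSet E) ((Fin n → Fin d) × workSet E) ℂ →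
      Matrix (workSet E) (workSet E) ℂ)
    (ρ : Matrix (Fin d) (Fin d) ℂ) (ε : ℝ) : EReal :=
  sSup {x : EReal | ∃ W : workSet E, x = ((W : ℝ) : EReal) ∧
    1 - ε ≤ fidelityBasis (Λ (tensorPower ρ n ⊗ₖ basisProj (workGround E))) W}

/-- `lim_{ε → +0} limsup_{n → ∞} W^ε(ρ^{⊗ n}, Λ_n) / n = R`. -/
def HasWorkRate {d : ℕ} (E : Fin d → ℝ)
    (Λ : ∀ n : ℕ, Matrix ((Fin n → Fin d) × workSet E) ((Fin n → Fin d) × workSet E) ℂ →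
      Matrix (workSet E) (workSet E) ℂ)
    (ρ : Matrix (Fin d) (Fin d) ℂ) (R : ℝ) : Prop :=
  Tendsto (fun ε : ℝ => limsup (fun n : ℕ => extractedWork E n (Λ n) ρ ε / (n : EReal)) atTop)
    (𝓝[>] 0) (𝓝 (R : EReal))

/-- `R` is an `S`-achievable state-agnostic work extraction rate: one sequence of thermal operations
attains the rate `R ρ` for every `ρ ∈ S`. -/
def IsAchievableAgnosticRate {d : ℕ} (β : ℝ) (E : Fin d → ℝ)
    (S : Set (Matrix (Fin d) (Fin d) ℂ)) (R : Matrix (Fin d) (Fin d) ℂ → ℝ) : Prop :=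
  ∃ Λ : ∀ n : ℕ, Matrix ((Fin n → Fin d) × workSet E) ((Fin n → Fin d) × workSet E) ℂ →
      Matrix (workSet E) (workSet E) ℂ,
    (∀ n, IsThermalOperation β (addEnergy (copiesEnergy E n) (workEnergy E)) (workEnergy E) (Λ n)) ∧
    ∀ ρ ∈ S, HasWorkRate E Λ ρ (R ρ)

/-- The Umegaki relative entropy `D(ρ‖σ) = Tr[ρ log ρ - ρ log σ]` (natural logarithm), for a state
`ρ` and a positive definite state `σ`.  As `Real.log 0 = 0`, the kernel of `ρ` contributes zero. -/
def relEntropy {d : ℕ} (ρ σ : Matrix (Fin d) (Fin d) ℂ) : ℝ :=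
  (Matrix.trace (ρ * cfc Real.log ρ - ρ * cfc Real.log σ)).re

end Thermo

end

/-!
There is an operator on `H^{⊗ n}` of polynomial trace that preserves types and dominates every
`ρ^{⊗ n}` up to a polynomial factor.  Its eigenvectors can be chosen of definite energy.  Measure
this basis, which does not depend on `ρ`, on `ρ^{⊗ n}`: except with vanishing probability the
outcome `x` has an eigenvalue `l x` of order `e^{-n S(ρ)}` and energy close to `n Tr[ρ H]`, so that
the score `β E(x) + log (l x) + n log Z` is close to `n D(ρ‖τ)`.

On the outcome `x`, work of about `β⁻¹` times the score is extracted.  Since the `l x` have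
polynomial sum, the outcomes yielding work `W` have total Gibbs weight at most `e^{-βW} / 2`, once a
logarithmic amount is subtracted from the score.  This is what allows a permutation of equal energy
levels of a degenerate bath to raise the storage by `W`.

To succeed with high probability nearly all outcomes must yield exactly the same work, so the score
per copy is rounded down to a slowly refining grid.  This fails when `D(ρ‖τ)` is next to a grid
point; as the grid is shifted between even and odd `n`, it works for infinitely many `n`, which
suffices for the `limsup`.
-/

noncomputable section

namespace Thermo

section Unitary

variable {ι κ X Y : Type*}

theorem isUnitary_iff_hasSum [DecidableEq ι] {U : Matrix ι ι ℂ} :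
    IsUnitary U ↔
      (∀ i j, HasSum (fun k => star (U k i) * U k j) ((1 : Matrix ι ι ℂ) i j)) ∧
        ∀ i j, HasSum (fun k => U i k * star (U j k)) ((1 : Matrix ι ι ℂ) i j) := by
  constructor
  · rintro ⟨hcol, hcol', hrow, hrow'⟩
    constructor <;> intro i j <;> rcases eq_or_ne i j with rfl | hij
    · simpa using hcol i
    · simpa [hij] using hcol' i j hij
    · simpa using hrow i
    · simpa [hij] using hrow' i j hij
  · rintro ⟨hcol, hrow⟩
    exact ⟨fun i => by simpa using hcol i i, fun i j hij => by simpa [hij] using hcol i j,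
      fun i => by simpa using hrow i i, fun i j hij => by simpa [hij] using hrow i j⟩

theorem isUnitary_of_mem_unitaryGroup [Fintype ι] [DecidableEq ι] {U : Matrix ι ι ℂ}
    (hU : U ∈ Matrix.unitaryGroup ι ℂ) : IsUnitary U := by
  refine isUnitary_iff_hasSum.2 ⟨fun i j => ?_, fun i j => ?_⟩
  · rw [← Matrix.mem_unitaryGroup_iff'.1 hU]
    exact hasSum_fintype _
  · rw [← Matrix.mem_unitaryGroup_iff.1 hU]
    exact hasSum_fintype _

theorem IsUnitary.submatrix {U : Matrix ι ι ℂ} (hU : IsUnitary U) (e₁ e₂ : κ ≃ ι) :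
    IsUnitary (U.submatrix e₁ e₂) := by
  classical
  obtain ⟨hcol, hrow⟩ := isUnitary_iff_hasSum.1 hU
  refine isUnitary_iff_hasSum.2 ⟨fun i j => ?_, fun i j => ?_⟩
  · simpa [Matrix.one_apply, Function.comp_def] using e₁.hasSum_iff.2 (hcol (e₂ i) (e₂ j))
  · simpa [Matrix.one_apply, Function.comp_def] using e₂.hasSum_iff.2 (hrow (e₁ i) (e₁ j))

theorem hasSum_prod_of_eq_zero {f : X × Y → ℂ} {a : ℂ} (y : Y) (hf : ∀ p, p.2 ≠ y → f p = 0)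
    (h : HasSum (fun x => f (x, y)) a) : HasSum f a := by
  refine ((Prod.mk_left_injective y).hasSum_iff fun p hp => hf p ?_).1 h
  rintro rfl
  exact hp ⟨p.1, rfl⟩

theorem IsUnitary.kronecker_one [DecidableEq Y] {U : Matrix X X ℂ} (hU : IsUnitary U) :
    IsUnitary (U ⊗ₖ (1 : Matrix Y Y ℂ)) := by
  classical
  obtain ⟨hcol, hrow⟩ := isUnitary_iff_hasSum.1 hU
  rw [isUnitary_iff_hasSum, ← Matrix.one_kronecker_one]
  refine ⟨fun ⟨i, y⟩ ⟨j, z⟩ => ?_, fun ⟨i, y⟩ ⟨j, z⟩ => ?_⟩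
  · refine hasSum_prod_of_eq_zero y (fun p hp => by simp [hp]) ?_
    simpa [mul_assoc] using (hcol i j).mul_right ((1 : Matrix Y Y ℂ) y z)
  · refine hasSum_prod_of_eq_zero y (fun p hp => by simp [hp.symm]) ?_
    rcases eq_or_ne y z with rfl | hyz
    · simpa using hrow i j
    · simp [hyz, hyz.symm, hasSum_zero]

theorem conjBy_eq_mul [Fintype ι] (U A : Matrix ι ι ℂ) : conjBy U A = U * A * U.conjTranspose := by
  ext i j
  simp only [conjBy, tsum_fintype, Fintype.sum_prod_type, Matrix.mul_apply, Finset.sum_mul,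
    Matrix.conjTranspose_apply]
  exact Finset.sum_comm

theorem conjBy_submatrix (U A : Matrix ι ι ℂ) (e₁ e₂ : κ ≃ ι) :
    conjBy (U.submatrix e₁ e₂) (A.submatrix e₂ e₂) = (conjBy U A).submatrix e₁ e₁ := by
  ext i j
  exact (Equiv.prodCongr e₂ e₂).tsum_eq
    fun p : ι × ι => U (e₁ i) p.1 * A p.1 p.2 * star (U (e₁ j) p.2)

theorem conjBy_kronecker_one [DecidableEq Y] (U A : Matrix X X ℂ) (B : Matrix Y Y ℂ) :
    conjBy (U ⊗ₖ (1 : Matrix Y Y ℂ)) (A ⊗ₖ B) = conjBy U A ⊗ₖ B := by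
  ext ⟨i, y⟩ ⟨j, z⟩
  have hinj : Function.Injective fun p : X × X => ((p.1, y), (p.2, z)) :=
    (Prod.mk_left_injective y).prodMap (Prod.mk_left_injective z)
  rw [Matrix.kroneckerMap_apply, conjBy, conjBy, ← tsum_mul_right, ← hinj.tsum_eq]
  · exact tsum_congr fun p => by simp; ring
  · rintro ⟨⟨a, y'⟩, ⟨b, z'⟩⟩ hp
    obtain rfl : y = y' := by by_contra h; simp [h] at hp
    obtain rfl : z = z' := by by_contra h; simp [h] at hp
    exact ⟨(a, b), rfl⟩

theorem conservesEnergy_iff {E : ι → ℝ} {U : Matrix ι ι ℂ} :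
    ConservesEnergy E U ↔ ∀ i j, U i j ≠ 0 → E i = E j := by
  refine forall₂_congr fun i j => ?_
  rw [mul_comm, mul_eq_mul_left_iff, Complex.ofReal_inj]
  tauto

theorem ConservesEnergy.submatrix_left {E : ι → ℝ} {U : Matrix ι ι ℂ} (hU : ConservesEnergy E U)
    {f : Equiv.Perm ι} (hf : ∀ i, E (f i) = E i) :
    ConservesEnergy E (U.submatrix f (Equiv.refl ι)) := fun i j => by
  simpa [hf] using hU (f i) j

theorem ConservesEnergy.kronecker_one [DecidableEq Y] {EX : X → ℝ} {U : Matrix X X ℂ}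
    (hU : ConservesEnergy EX U) (EY : Y → ℝ) :
    ConservesEnergy (addEnergy EX EY) (U ⊗ₖ (1 : Matrix Y Y ℂ)) := by
  rw [conservesEnergy_iff] at hU ⊢
  rintro ⟨i, y⟩ ⟨j, z⟩ h
  rw [Matrix.kroneckerMap_apply] at h
  obtain rfl : y = z := by by_contra hyz; simp [hyz] at h
  rw [addEnergy, addEnergy, hU i j (left_ne_zero_of_mul h)]

end Unitary

section Gibbs

variable {κ : Type*} (β : ℝ) (E : κ → ℝ)

/-- The Gibbs distribution: the eigenvalues `e^{-βE} / Tr e^{-βH}` of the Gibbs state. -/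
def gibbsWeight (k : κ) : ℝ := Real.exp (-β * E k) / partitionFn β E

theorem gibbsWeight_nonneg (k : κ) : 0 ≤ gibbsWeight β E k :=
  div_nonneg (Real.exp_nonneg _) (tsum_nonneg fun _ => Real.exp_nonneg _)

theorem gibbs_eq_diagonal [DecidableEq κ] :
    gibbs β E = Matrix.diagonal fun k => (gibbsWeight β E k : ℂ) := by
  rw [gibbs]
  congr!

variable [Nonempty κ]

theorem partitionFn_pos [Finite κ] : 0 < partitionFn β E := by
  cases nonempty_fintype κ
  rw [partitionFn, tsum_fintype]
  exact Finset.sum_pos (fun _ _ => Real.exp_pos _) Finset.univ_nonempty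

theorem gibbsWeight_pos [Finite κ] (k : κ) : 0 < gibbsWeight β E k :=
  div_pos (Real.exp_pos _) (partitionFn_pos β E)

theorem log_gibbsWeight [Finite κ] (k : κ) :
    Real.log (gibbsWeight β E k) = -β * E k - Real.log (partitionFn β E) := by
  rw [gibbsWeight, Real.log_div (Real.exp_pos _).ne' (partitionFn_pos β E).ne', Real.log_exp]

theorem sum_gibbsWeight [Fintype κ] : ∑ k, gibbsWeight β E k = 1 := by
  simp only [gibbsWeight, ← Finset.sum_div]
  rw [← tsum_fintype (L := .unconditional κ), ← partitionFn, div_self (partitionFn_pos β E).ne']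

end Gibbs

section RotatedWeight

variable {X : Type*} [Fintype X]

/-- The probability `⟨x|UρU†|x⟩` of measuring the basis state `x` after applying `U` to `ρ`. -/
def rotatedWeight (U ρ : Matrix X X ℂ) (x : X) : ℝ := ((U * ρ * U.conjTranspose) x x).re

theorem rotatedWeight_nonneg {ρ : Matrix X X ℂ} (hρ : ρ.PosSemidef) (U : Matrix X X ℂ) (x : X) :
    0 ≤ rotatedWeight U ρ x :=
  (Complex.le_def.1 ((hρ.mul_mul_conjTranspose_same U).diag_nonneg (i := x))).1

theorem sum_rotatedWeight [DecidableEq X] {U : Matrix X X ℂ} (hU : U ∈ Matrix.unitaryGroup X ℂ)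
    (ρ : Matrix X X ℂ) : ∑ x, rotatedWeight U ρ x = ρ.trace.re := by
  simp only [rotatedWeight]
  rw [← Complex.re_sum]
  change (Matrix.trace (U * ρ * star U)).re = _
  rw [Matrix.trace_mul_cycle, Matrix.mem_unitaryGroup_iff'.1 hU, one_mul]

end RotatedWeight

section StorageOperation

variable {X Ω κ : Type} {EX : X → ℝ} {EΩ : Ω → ℝ} {EK : κ → ℝ}

/-- The decomposition of input and bath into the work storage, as output, and a remainder. -/
def storageEquiv (X Ω κ : Type) : (X × Ω) × κ ≃ Ω × (X × κ) where
  toFun p := (p.1.2, (p.1.1, p.2))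
  invFun p := ((p.2.1, p.1), p.2.2)

/-- The operation that attaches a bath, applies `U` to the system, permutes the joint energy basis
by `f`, and keeps the work storage. -/
def storageOperation [DecidableEq Ω] [DecidableEq κ] (β : ℝ) (EK : κ → ℝ) (U : Matrix X X ℂ)
    (f : Equiv.Perm ((X × Ω) × κ)) (ρ : Matrix (X × Ω) (X × Ω) ℂ) : Matrix Ω Ω ℂ :=
  partialTrace ((conjBy
      (((U ⊗ₖ (1 : Matrix Ω Ω ℂ)) ⊗ₖ (1 : Matrix κ κ ℂ)).submatrix f.symm (Equiv.refl _))
      (ρ ⊗ₖ gibbs β EK)).submatrix (storageEquiv X Ω κ).symm (storageEquiv X Ω κ).symm)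

theorem isThermalOperation_storageOperation [DecidableEq Ω] [DecidableEq κ] {β : ℝ}
    (hEK : Summable fun k => Real.exp (-β * EK k)) {U : Matrix X X ℂ} (hU : IsUnitary U)
    (hUE : ConservesEnergy EX U) {f : Equiv.Perm ((X × Ω) × κ)}
    (hf : ∀ p, addEnergy (addEnergy EX EΩ) EK (f p) = addEnergy (addEnergy EX EΩ) EK p) :
    IsThermalOperation β (addEnergy EX EΩ) EΩ (storageOperation β EK U f) := by
  refine ⟨κ, X × κ, EK, addEnergy EX EK, storageEquiv X Ω κ, _, hEK, ?_,
    hU.kronecker_one.kronecker_one.submatrix _ _,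
    ((hUE.kronecker_one EΩ).kronecker_one EK).submatrix_left (f := f.symm) fun p => ?_,
    fun ρ _ => rfl⟩
  · rintro ⟨⟨x, ω⟩, k⟩
    simp only [addEnergy, storageEquiv, Equiv.coe_fn_mk]
    ring
  · simpa using (hf (f.symm p)).symm

variable [Fintype X] [Fintype κ] [DecidableEq Ω] [DecidableEq κ]

theorem fidelityBasis_storageOperation_symm (β : ℝ) (EK : κ → ℝ) (U : Matrix X X ℂ)
    (f : Equiv.Perm ((X × Ω) × κ)) (ρ : Matrix X X ℂ) (ω₀ ω : Ω) :
    fidelityBasis (storageOperation β EK U f (ρ ⊗ₖ basisProj ω₀)) ω =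
      ∑ p : X × κ with (f.symm ((p.1, ω), p.2)).1.2 = ω₀,
        rotatedWeight U ρ (f.symm ((p.1, ω), p.2)).1.1 *
          gibbsWeight β EK (f.symm ((p.1, ω), p.2)).2 := by
  have hstate : conjBy
      (((U ⊗ₖ (1 : Matrix Ω Ω ℂ)) ⊗ₖ (1 : Matrix κ κ ℂ)).submatrix f.symm (Equiv.refl _))
      ((ρ ⊗ₖ basisProj ω₀) ⊗ₖ gibbs β EK) =
      (((U * ρ * U.conjTranspose) ⊗ₖ basisProj ω₀) ⊗ₖ gibbs β EK).submatrix f.symm f.symm := by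
    rw [← conjBy_eq_mul, ← conjBy_kronecker_one, ← conjBy_kronecker_one, ← conjBy_submatrix]
    rfl
  have hdiag (q : (X × Ω) × κ) :
      ((((U * ρ * U.conjTranspose) ⊗ₖ basisProj ω₀) ⊗ₖ gibbs β EK) q q).re =
        if q.1.2 = ω₀ then rotatedWeight U ρ q.1.1 * gibbsWeight β EK q.2 else 0 := by
    rw [gibbs_eq_diagonal]
    by_cases h : q.1.2 = ω₀
    · simp [basisProj, rotatedWeight, h]
    · simp [basisProj, h, Ne.symm h]
  simp only [fidelityBasis, storageOperation, partialTrace, hstate, tsum_fintype, Complex.re_sum,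
    Finset.sum_filter]
  exact Finset.sum_congr rfl fun p _ => hdiag _

theorem fidelityBasis_storageOperation (β : ℝ) (EK : κ → ℝ) (U : Matrix X X ℂ)
    (f : Equiv.Perm ((X × Ω) × κ)) (ρ : Matrix X X ℂ) (ω₀ ω : Ω) :
    fidelityBasis (storageOperation β EK U f (ρ ⊗ₖ basisProj ω₀)) ω =
      ∑ p : X × κ with (f ((p.1, ω₀), p.2)).1.2 = ω,
        rotatedWeight U ρ p.1 * gibbsWeight β EK p.2 := by
  rw [fidelityBasis_storageOperation_symm]
  refine Finset.sum_bij'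
    (fun p _ => ((f.symm ((p.1, ω), p.2)).1.1, (f.symm ((p.1, ω), p.2)).2))
    (fun p _ => ((f ((p.1, ω₀), p.2)).1.1, (f ((p.1, ω₀), p.2)).2)) ?_ ?_ ?_ ?_ fun _ _ => rfl
  all_goals
    rintro ⟨x, k⟩ h
    simp only [Finset.mem_filter, Finset.mem_univ, true_and] at h ⊢
    simp [← h]

/-- `Λ`, applied to `ρ` with the storage in `ω₀`, behaves up to an error `η` as if it measured the
basis rotated by `U` and, on outcome `x`, raised the storage to `w x`.  The error may leave the
storage in `ω₀`, so at `ω₀` only the lower bound is required. -/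
def ImplementsAssignment (Λ : Matrix (X × Ω) (X × Ω) ℂ → Matrix Ω Ω ℂ) (U : Matrix X X ℂ)
    (w : X → Ω) (ω₀ : Ω) (η : ℝ) : Prop :=
  ∀ ρ : Matrix X X ℂ, ρ.PosSemidef → ∀ ω,
    (1 - η) * ∑ x with w x = ω, rotatedWeight U ρ x ≤ fidelityBasis (Λ (ρ ⊗ₖ basisProj ω₀)) ω ∧
      (ω ≠ ω₀ →
        fidelityBasis (Λ (ρ ⊗ₖ basisProj ω₀)) ω ≤ ∑ x with w x = ω, rotatedWeight U ρ x)

theorem implementsAssignment_storageOperation [Nonempty κ] (β : ℝ) (U : Matrix X X ℂ)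
    {f : Equiv.Perm ((X × Ω) × κ)} {w : X → Ω} {ω₀ : Ω} {η : ℝ} {good : Finset κ}
    (hgood : 1 - η ≤ ∑ k ∈ good, gibbsWeight β EK k)
    (hf : ∀ x, ∀ k ∈ good, (f ((x, ω₀), k)).1.2 = w x)
    (hf₀ : ∀ x k, (f ((x, ω₀), k)).1.2 = w x ∨ (f ((x, ω₀), k)).1.2 = ω₀) :
    ImplementsAssignment (storageOperation β EK U f) U w ω₀ η := by
  intro ρ hρ ω
  have hP := rotatedWeight_nonneg hρ U
  have hnonneg (p : X × κ) : 0 ≤ rotatedWeight U ρ p.1 * gibbsWeight β EK p.2 :=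
    mul_nonneg (hP _) (gibbsWeight_nonneg β EK _)
  have hprod (s : Finset κ) :
      (∑ k ∈ s, gibbsWeight β EK k) * ∑ x with w x = ω, rotatedWeight U ρ x =
        ∑ p ∈ ({x | w x = ω} : Finset X) ×ˢ s, rotatedWeight U ρ p.1 * gibbsWeight β EK p.2 := by
    rw [mul_comm, Finset.sum_mul_sum, Finset.sum_product]
  rw [fidelityBasis_storageOperation]
  refine ⟨?_, fun hω => ?_⟩
  · refine (mul_le_mul_of_nonneg_right hgood (Finset.sum_nonneg fun x _ => hP x)).trans ?_
    rw [hprod]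
    refine Finset.sum_le_sum_of_subset_of_nonneg (fun p hp => ?_) fun p _ _ => hnonneg p
    simp only [Finset.mem_product, Finset.mem_filter, Finset.mem_univ, true_and] at hp ⊢
    rw [hf p.1 p.2 hp.2, hp.1]
  · rw [← one_mul (∑ x with w x = ω, _), ← sum_gibbsWeight β EK, hprod]
    refine Finset.sum_le_sum_of_subset_of_nonneg (fun p hp => ?_) fun p _ _ => hnonneg p
    simp only [Finset.mem_product, Finset.mem_filter, Finset.mem_univ, true_and, and_true] at hp ⊢
    exact ((hf₀ p.1 p.2).resolve_right (hp.trans_ne hω)).symm.trans hp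

end StorageOperation

section Permutation

theorem exists_perm_swap {T : Type*} {G : Set T} {g : T → T} (hg : Set.InjOn g G)
    (hG : ∀ s ∈ G, g s ∉ G) :
    ∃ f : Equiv.Perm T, (∀ s ∈ G, f s = g s) ∧ (∀ s ∈ G, f (g s) = s) ∧
      ∀ t ∉ G, t ∉ g '' G → f t = t := by
  classical
  rcases isEmpty_or_nonempty T with _ | _
  · exact ⟨1, isEmptyElim, isEmptyElim, isEmptyElim⟩
  let F : T → T := fun t => if t ∈ G then g t else if t ∈ g '' G then Function.invFunOn g G t else t
  have hF (s) (hs : s ∈ G) : F s = g s := if_pos hs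
  have hFg (s) (hs : s ∈ G) : F (g s) = s := by
    simp only [F, if_neg (hG s hs), if_pos (Set.mem_image_of_mem g hs)]
    exact hg.leftInvOn_invFunOn hs
  have hFid (t) (ht : t ∉ G) (ht' : t ∉ g '' G) : F t = t := by simp only [F, if_neg ht, if_neg ht']
  have hinv : Function.Involutive F := by
    intro t
    by_cases ht : t ∈ G
    · rw [hF t ht, hFg t ht]
    by_cases ht' : t ∈ g '' G
    · obtain ⟨s, hs, rfl⟩ := ht'
      rw [hFg s hs, hF s hs]
    · rw [hFid t ht ht', hFid t ht ht']
  exact ⟨hinv.toPerm, hF, hFg, hFid⟩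

theorem exists_injOn_of_encard_fiber_le {T L : Type*} {G : Set T} (hG : G.Finite) (ℓ m : T → L)
    (hcard : ∀ s ∈ G, {s' ∈ G | ℓ s' = ℓ s}.encard ≤ {t | m t = ℓ s}.encard) :
    ∃ g : T → T, Set.InjOn g G ∧ ∀ s ∈ G, m (g s) = ℓ s := by
  have hfiber (l : L) : ∃ φ : T → T,
      Set.MapsTo φ {s ∈ G | ℓ s = l} {t | m t = l} ∧ Set.InjOn φ {s ∈ G | ℓ s = l} := by
    rcases {s ∈ G | ℓ s = l}.eq_empty_or_nonempty with h | ⟨s, hs, rfl⟩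
    · exact ⟨id, by simpa only [h] using Set.mapsTo_empty id _, by simp [h]⟩
    · have : Nonempty T := ⟨s⟩
      exact (hG.subset (Set.sep_subset _ _)).exists_injOn_of_encard_le (hcard s hs)
  choose φ hmaps hinj using hfiber
  have hm (s) (hs : s ∈ G) : m (φ (ℓ s) s) = ℓ s := hmaps (ℓ s) ⟨hs, rfl⟩
  refine ⟨fun s => φ (ℓ s) s, fun s hs t ht hst => ?_, hm⟩
  have hℓ : ℓ s = ℓ t := by rw [← hm s hs, ← hm t ht]; exact congrArg m hst
  exact hinj (ℓ t) ⟨hs, hℓ⟩ ⟨ht, rfl⟩ (by simpa [hℓ] using hst)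

theorem exists_perm_raise {T Ω A : Type*} (Q : T → A) (σ w : T → Ω) (ω₀ : Ω)
    (hfin : {t | σ t = ω₀}.Finite) :
    ∃ f : Equiv.Perm T, (∀ t, Q (f t) = Q t) ∧
      (∀ t, σ t = ω₀ → (w t ≠ ω₀ → {s | σ s = ω₀ ∧ w s = w t ∧ Q s = Q t}.encard ≤
        {s | σ s = w t ∧ Q s = Q t}.encard) → σ (f t) = w t) ∧
      ∀ t, σ t = ω₀ → σ (f t) = w t ∨ σ (f t) = ω₀ := by
  let G : Set T := {t | σ t = ω₀ ∧ w t ≠ ω₀ ∧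
    {s | σ s = ω₀ ∧ w s = w t ∧ Q s = Q t}.encard ≤ {s | σ s = w t ∧ Q s = Q t}.encard}
  obtain ⟨g, hinj, hg⟩ := exists_injOn_of_encard_fiber_le
    (hfin.subset fun t (ht : t ∈ G) => ht.1) (fun t => (w t, Q t)) (fun t => (σ t, Q t))
    fun t ht => by
      simp only [Prod.mk.injEq]
      refine le_trans (Set.encard_le_encard ?_) ht.2.2
      exact fun s hs => ⟨hs.1.1, hs.2⟩
  have hgσ (s) (hs : s ∈ G) : σ (g s) = w s := congrArg Prod.fst (hg s hs)
  have hgQ (s) (hs : s ∈ G) : Q (g s) = Q s := congrArg Prod.snd (hg s hs)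
  have himage (t) (ht : t ∈ g '' G) : σ t ≠ ω₀ := by
    obtain ⟨s, hs, rfl⟩ := ht
    exact (hgσ s hs).trans_ne hs.2.1
  obtain ⟨f, hf, hfg, hfid⟩ := exists_perm_swap hinj
    fun s hs h => himage _ (Set.mem_image_of_mem g hs) h.1
  have hfix (t) (ht : σ t = ω₀) (htG : t ∉ G) : f t = t := hfid t htG fun h => himage t h ht
  refine ⟨f, fun t => ?_, fun t ht hcard => ?_, fun t ht => ?_⟩
  · by_cases htG : t ∈ G
    · rw [hf t htG, hgQ t htG]
    by_cases ht : t ∈ g '' G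
    · obtain ⟨s, hs, rfl⟩ := ht
      rw [hfg s hs, hgQ s hs]
    · rw [hfid t htG ht]
  · by_cases hw : w t = ω₀
    · rw [hfix t ht fun h => h.2.1 hw, ht, hw]
    · rw [hf t ⟨ht, hw, hcard hw⟩, hgσ t ⟨ht, hw, hcard hw⟩]
  · by_cases htG : t ∈ G
    · exact .inl (by rw [hf t htG, hgσ t htG])
    · exact .inr (by rw [hfix t ht htG, ht])

end Permutation

section Bath

variable {ι : Type*} [Fintype ι] (β : ℝ) (E : ι → ℝ) (B : Finset (ι → ℤ))

/-- The energy `∑ i, K i * E i` of an integer occupation vector `K`. -/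
def occEnergy : (ι → ℤ) →+ ℝ where
  toFun K := ∑ i, (K i : ℝ) * E i
  map_zero' := by simp
  map_add' K L := by simp [add_mul, Finset.sum_add_distrib]

/-- The scale of the bath degeneracies, large enough for `bathScale * e^{βE(K)}` to be at least `1`
on all of `B`, so that rounding it to an integer costs at most a factor `2`. -/
def bathScale : ℝ := ∑ K ∈ B, Real.exp (-β * occEnergy E K)

/-- The number of levels of the bath with occupation vector `K`, growing like `e^{βE(K)}`. -/
def bathDegeneracy (K : ι → ℤ) : ℕ := ⌈bathScale β E B * Real.exp (β * occEnergy E K)⌉₊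

/-- The energy levels of a bath with occupation vectors in `B` and exponential degeneracies. -/
abbrev BathIndex : Type _ := Σ K : B, Fin (bathDegeneracy β E B K)

/-- The energies of the levels of the bath. -/
def bathEnergy (k : BathIndex β E B) : ℝ := occEnergy E k.1

theorem bathScale_mul_exp_le (K : ι → ℤ) :
    bathScale β E B * Real.exp (β * occEnergy E K) ≤ bathDegeneracy β E B K :=
  Nat.le_ceil _

theorem exp_mul_exp_neg (t : ℝ) : Real.exp t * Real.exp (-t) = 1 := by
  rw [← Real.exp_add, add_neg_cancel, Real.exp_zero]

variable {B}

theorem bathScale_pos (hB : B.Nonempty) : 0 < bathScale β E B :=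
  Finset.sum_pos (fun _ _ => Real.exp_pos _) hB

theorem one_le_bathScale_mul_exp {K : ι → ℤ} (hK : K ∈ B) :
    1 ≤ bathScale β E B * Real.exp (β * occEnergy E K) := by
  rw [← exp_mul_exp_neg (β * occEnergy E K), mul_comm, ← neg_mul]
  exact mul_le_mul_of_nonneg_right (Finset.single_le_sum
    (f := fun K => Real.exp (-β * occEnergy E K)) (fun _ _ => Real.exp_nonneg _) hK)
    (Real.exp_nonneg _)

theorem bathDegeneracy_le {K : ι → ℤ} (hK : K ∈ B) :
    (bathDegeneracy β E B K : ℝ) ≤ 2 * (bathScale β E B * Real.exp (β * occEnergy E K)) := by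
  have hone := one_le_bathScale_mul_exp β E hK
  have hceil := Nat.ceil_lt_add_one (zero_le_one.trans hone)
  rw [bathDegeneracy]
  linarith

theorem nonempty_bathIndex (hB : B.Nonempty) : Nonempty (BathIndex β E B) := by
  obtain ⟨K, hK⟩ := hB
  exact ⟨⟨K, hK⟩, 0, Nat.ceil_pos.2 (one_pos.trans_le (one_le_bathScale_mul_exp β E hK))⟩

theorem sum_bathIndex {M : Type*} [AddCommMonoid M] (f : (ι → ℤ) → M) :
    ∑ k : BathIndex β E B, f k.1 = ∑ K ∈ B, bathDegeneracy β E B K • f K := by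
  rw [Fintype.sum_sigma, ← Finset.sum_coe_sort B]
  simp

section Weight

variable {β E} {I : Finset (ι → ℤ)}

theorem sum_exp_neg_bathEnergy (hIB : I ⊆ B) :
    ∑ k : BathIndex β E B with (k.1 : ι → ℤ) ∈ I, Real.exp (-β * bathEnergy β E B k) =
      ∑ K ∈ I, bathDegeneracy β E B K * Real.exp (-β * occEnergy E K) := by
  rw [Finset.sum_filter]
  refine (sum_bathIndex β E fun K => if K ∈ I then Real.exp (-β * occEnergy E K) else 0).trans ?_
  simp only [smul_ite, smul_zero, nsmul_eq_mul]
  rw [← Finset.sum_filter, Finset.filter_mem_eq_inter, Finset.inter_eq_right.2 hIB]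

theorem card_mul_bathScale_le (I : Finset (ι → ℤ)) :
    I.card * bathScale β E B ≤ ∑ K ∈ I, bathDegeneracy β E B K * Real.exp (-β * occEnergy E K) := by
  rw [← nsmul_eq_mul]
  refine Finset.card_nsmul_le_sum _ _ _ fun K _ => ?_
  calc bathScale β E B = bathScale β E B * Real.exp (β * occEnergy E K) *
        Real.exp (-β * occEnergy E K) := by rw [mul_assoc, neg_mul, exp_mul_exp_neg, mul_one]
    _ ≤ _ := mul_le_mul_of_nonneg_right (bathScale_mul_exp_le β E B K) (Real.exp_nonneg _)

theorem le_card_mul_bathScale (hIB : I ⊆ B) :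
    ∑ K ∈ I, bathDegeneracy β E B K * Real.exp (-β * occEnergy E K) ≤
      I.card * (2 * bathScale β E B) := by
  rw [← nsmul_eq_mul]
  refine Finset.sum_le_card_nsmul _ _ _ fun K hK => ?_
  calc _ ≤ 2 * (bathScale β E B * Real.exp (β * occEnergy E K)) * Real.exp (-β * occEnergy E K) :=
        mul_le_mul_of_nonneg_right (bathDegeneracy_le β E (hIB hK)) (Real.exp_nonneg _)
    _ = 2 * bathScale β E B := by rw [mul_assoc, mul_assoc, neg_mul, exp_mul_exp_neg, mul_one]

theorem one_sub_le_sum_gibbsWeight_bathEnergy {η : ℝ} (hη : 0 ≤ η) (hB : B.Nonempty) (hIB : I ⊆ B)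
    (hI : (1 - η) * B.card ≤ I.card) :
    1 - 2 * η ≤
      ∑ k : BathIndex β E B with (k.1 : ι → ℤ) ∈ I, gibbsWeight β (bathEnergy β E B) k := by
  have := nonempty_bathIndex β E hB
  have hZ := partitionFn_pos β (bathEnergy β E B)
  set Z := partitionFn β (bathEnergy β E B) with hZdef
  have hZsum : Z = ∑ K ∈ B, bathDegeneracy β E B K * Real.exp (-β * occEnergy E K) := by
    rw [hZdef, partitionFn, tsum_fintype, ← sum_exp_neg_bathEnergy subset_rfl]
    simp
  have hlower : B.card * bathScale β E B ≤ Z := hZsum ▸ card_mul_bathScale_le B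
  have hupper := le_card_mul_bathScale (β := β) (E := E) (Finset.sdiff_subset : B \ I ⊆ B)
  rw [Finset.cast_card_sdiff hIB] at hupper
  simp only [gibbsWeight]
  rw [← Finset.sum_div, sum_exp_neg_bathEnergy hIB, le_div_iff₀ hZ]
  have hsplit := Finset.sum_sdiff (f := fun K => bathDegeneracy β E B K *
    Real.exp (-β * occEnergy E K)) hIB
  have houter : (B.card - I.card) * (2 * bathScale β E B) ≤ 2 * η * Z :=
    calc _ ≤ η * B.card * (2 * bathScale β E B) :=
          mul_le_mul_of_nonneg_right (by linarith) (by linarith [bathScale_pos β E hB])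
      _ = 2 * η * (B.card * bathScale β E B) := by ring
      _ ≤ 2 * η * Z := mul_le_mul_of_nonneg_left hlower (by linarith)
  linarith

end Weight

section Counting

variable {X Ω : Type*}

theorem encard_setOf_bathIndex (s : Finset X) (h : X → ι → ℤ) (ω : Ω) :
    {t : (X × Ω) × BathIndex β E B | t.1.2 = ω ∧ t.1.1 ∈ s ∧ (t.2.1 : ι → ℤ) = h t.1.1}.encard =
      (∑ x ∈ s, if h x ∈ B then bathDegeneracy β E B (h x) else 0 : ℕ) := by
  classical
  have hinj : Function.Injective fun p : X × BathIndex β E B => ((p.1, ω), p.2) :=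
    (Prod.mk_left_injective ω).prodMap Function.injective_id
  have himage : {t : (X × Ω) × BathIndex β E B |
      t.1.2 = ω ∧ t.1.1 ∈ s ∧ (t.2.1 : ι → ℤ) = h t.1.1} =
      (fun p : X × BathIndex β E B => ((p.1, ω), p.2)) ''
        ({p ∈ s ×ˢ Finset.univ | (p.2.1 : ι → ℤ) = h p.1} : Finset (X × BathIndex β E B)) := by
    ext ⟨⟨x, ω'⟩, k⟩
    simp [and_comm, and_left_comm, eq_comm]
  rw [himage, hinj.encard_image, Set.encard_coe_eq_coe_finsetCard, Finset.card_filter,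
    Finset.sum_product]
  congr 1
  refine Finset.sum_congr rfl fun x _ => ?_
  rw [sum_bathIndex β E fun K => if K = h x then 1 else 0]
  simp

variable {β E} [Fintype X]

/-- Raising the storage by `W` costs a factor `e^{-βW}` in the number of available levels. -/
theorem encard_raise_source_le_target {EX : X → ℝ} {t : X → ι → ℤ}
    (hEX : ∀ x, EX x = occEnergy E (t x)) (s : Finset X) {K₀ K L : ι → ℤ} (ω₀ ω : Ω)
    (hK₀ : occEnergy E K₀ = 0) (hs : 2 * ∑ x ∈ s, Real.exp (-β * EX x) ≤
      Real.exp (-β * occEnergy E K) * ∑ x, Real.exp (-β * EX x))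
    (hL : ∀ x, L - K - t x ∈ B) :
    {u : (X × Ω) × BathIndex β E B |
        u.1.2 = ω₀ ∧ u.1.1 ∈ s ∧ (u.2.1 : ι → ℤ) = L - K₀ - t u.1.1}.encard ≤
      {u : (X × Ω) × BathIndex β E B |
        u.1.2 = ω ∧ u.1.1 ∈ Finset.univ ∧ (u.2.1 : ι → ℤ) = L - K - t u.1.1}.encard := by
  rw [encard_setOf_bathIndex β E s fun x => L - K₀ - t x,
    encard_setOf_bathIndex β E Finset.univ fun x => L - K - t x, Nat.cast_le,
    ← Nat.cast_le (α := ℝ)]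
  push_cast
  let c := bathScale β E B * Real.exp (β * occEnergy E L)
  have hc₀ : 0 ≤ c :=
    mul_nonneg (Finset.sum_nonneg fun _ _ => Real.exp_nonneg _) (Real.exp_nonneg _)
  have hexp (J : ι → ℤ) (x : X) : bathScale β E B * Real.exp (β * occEnergy E (L - J - t x)) =
      c * (Real.exp (-β * occEnergy E J) * Real.exp (-β * EX x)) := by
    rw [mul_assoc, ← Real.exp_add, ← Real.exp_add, map_sub, map_sub, hEX]
    ring_nf
  calc ∑ x ∈ s, (if L - K₀ - t x ∈ B then (bathDegeneracy β E B (L - K₀ - t x) : ℝ) else 0)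
      ≤ ∑ x ∈ s, 2 * (c * Real.exp (-β * EX x)) := by
        refine Finset.sum_le_sum fun x _ => ?_
        split_ifs with hx
        · refine (bathDegeneracy_le β E hx).trans_eq ?_
          rw [hexp, hK₀, mul_zero, Real.exp_zero, one_mul]
        · positivity
    _ = c * (2 * ∑ x ∈ s, Real.exp (-β * EX x)) := by
        rw [← Finset.mul_sum, ← Finset.mul_sum]
        ring
    _ ≤ c * (Real.exp (-β * occEnergy E K) * ∑ x, Real.exp (-β * EX x)) :=
        mul_le_mul_of_nonneg_left hs hc₀
    _ = ∑ x, bathScale β E B * Real.exp (β * occEnergy E (L - K - t x)) := by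
        simp only [hexp, Finset.mul_sum]
    _ ≤ ∑ x, (if L - K - t x ∈ B then (bathDegeneracy β E B (L - K - t x) : ℝ) else 0) := by
        refine Finset.sum_le_sum fun x _ => ?_
        rw [if_pos (hL x)]
        exact bathScale_mul_exp_le β E B _

end Counting

end Bath

/-- Large boxes in `ℤ ^ ι` have a relatively small boundary. -/
theorem exists_finset_add_mem (ι : Type*) [Finite ι] (V : Finset (ι → ℤ)) {η : ℝ} (hη : 0 < η) :
    ∃ B I : Finset (ι → ℤ), B.Nonempty ∧ I ⊆ B ∧ (1 - η) * B.card ≤ I.card ∧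
      ∀ K ∈ I, ∀ v ∈ V, K + v ∈ B := by
  classical
  cases nonempty_fintype ι
  set c : ℕ := V.sup fun v => Finset.univ.sup fun i => (v i).natAbs
  have hc (v) (hv : v ∈ V) (i) : (v i).natAbs ≤ c :=
    (Finset.le_sup (f := fun i => (v i).natAbs) (Finset.mem_univ i)).trans
      (Finset.le_sup (f := fun v => Finset.univ.sup fun i => (v i).natAbs) hv)
  have hlim : Tendsto (fun M : ℕ => (1 - 2 * c / (M : ℝ)) ^ Fintype.card ι) atTop (𝓝 1) := by
    simpa using ((tendsto_const_div_atTop_nhds_zero_nat (2 * c : ℝ)).const_sub 1).pow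
      (Fintype.card ι)
  obtain ⟨M, hM, hcM⟩ := ((hlim.eventually_const_lt (sub_lt_self 1 hη)).and
    (eventually_gt_atTop (2 * c))).exists
  have hM₀ : (0 : ℝ) < M := by exact_mod_cast (Nat.zero_le _).trans_lt hcM
  refine ⟨Fintype.piFinset fun _ => Finset.Ico 0 M, Fintype.piFinset fun _ => Finset.Ico c (M - c),
    ⟨0, ?_⟩, fun K hK => ?_, ?_, fun K hK v hv => ?_⟩
  · simpa using fun _ => (Nat.zero_le _).trans_lt hcM
  · simp only [Fintype.mem_piFinset, Finset.mem_Ico] at hK ⊢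
    exact fun i => by have := hK i; omega
  · have hside : ((M : ℤ) - c - c).toNat = M - 2 * c := by omega
    have hsub : ((M - 2 * c : ℕ) : ℝ) = M * (1 - 2 * c / M) := by
      rw [Nat.cast_sub hcM.le]
      push_cast
      field_simp
    simp only [Fintype.card_piFinset, Int.card_Ico, hside, Finset.prod_const, Finset.card_univ,
      Nat.cast_pow, hsub, sub_zero, Int.toNat_natCast, mul_pow]
    rw [mul_comm]
    exact mul_le_mul_of_nonneg_left hM.le (by positivity)
  · simp only [Fintype.mem_piFinset, Finset.mem_Ico, Pi.add_apply] at hK ⊢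
    exact fun i => by have := hK i; have := hc v hv i; omega


section WorkExtraction

variable {X Ω : Type} [Fintype X] [DecidableEq Ω] {ι : Type} [Fintype ι] {β : ℝ} {E : ι → ℝ}
  {EX : X → ℝ} {EΩ : Ω → ℝ} {t : X → ι → ℤ} {N : Ω → ι → ℤ}

/-- The factor `2` in `hw` pays for rounding the degeneracies of the bath to integers. -/
theorem exists_isThermalOperation_implementsAssignment
    (hEX : ∀ x, EX x = occEnergy E (t x)) (hEΩ : ∀ ω, EΩ ω = occEnergy E (N ω))
    {U : Matrix X X ℂ} (hU : IsUnitary U) (hUE : ConservesEnergy EX U) {ω₀ : Ω} (hω₀ : EΩ ω₀ = 0)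
    (w : X → Ω) (hw : ∀ ω, ω ≠ ω₀ → 2 * ∑ x with w x = ω, Real.exp (-β * EX x) ≤
      Real.exp (-β * EΩ ω) * ∑ x, Real.exp (-β * EX x)) {η : ℝ} (hη : 0 < η) :
    ∃ Λ, IsThermalOperation β (addEnergy EX EΩ) EΩ Λ ∧ ImplementsAssignment Λ U w ω₀ η := by
  classical
  obtain ⟨B, I, hB, hIB, hI, hshift⟩ := exists_finset_add_mem ι
    (Finset.univ.image fun p : X × X => t p.1 + N ω₀ - N (w p.1) - t p.2) (half_pos hη)
  have := nonempty_bathIndex β E hB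
  let Q : (X × Ω) × BathIndex β E B → ι → ℤ := fun u => t u.1.1 + N u.1.2 + u.2.1
  have henergy (u) : addEnergy (addEnergy EX EΩ) (bathEnergy β E B) u = occEnergy E (Q u) := by
    simp only [addEnergy, bathEnergy, Q, map_add, hEX, hEΩ]
  obtain ⟨f, hfQ, hfw, hf₀⟩ := exists_perm_raise Q (fun u => u.1.2) (fun u => w u.1.1) ω₀
    (Set.toFinite ((fun p : X × BathIndex β E B => ((p.1, ω₀), p.2)) '' Set.univ) |>.subset
      fun u hu => ⟨(u.1.1, u.2), trivial, by rw [← hu]⟩)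
  refine ⟨storageOperation β (bathEnergy β E B) U f, isThermalOperation_storageOperation
    (hasSum_fintype _).summable hU hUE fun u => by rw [henergy, henergy, hfQ],
    implementsAssignment_storageOperation β U (good := {k | (k.1 : ι → ℤ) ∈ I})
      (by simpa [mul_div_cancel₀] using
        one_sub_le_sum_gibbsWeight_bathEnergy (half_pos hη).le hB hIB hI)
      (fun x k hk => hfw _ rfl fun hx => ?_) fun x k => hf₀ _ rfl⟩
  refine le_trans (Set.encard_le_encard ?_) ((encard_raise_source_le_target hEX
    (s := {x' | w x' = w x}) (K₀ := N ω₀) (K := N (w x)) (L := t x + N ω₀ + k.1) ω₀ (w x)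
    (by rw [← hEΩ, hω₀]) (by rw [← hEΩ]; exact hw _ hx) fun x' => ?_).trans
      (Set.encard_le_encard ?_))
  · rintro ⟨⟨x', ω⟩, k'⟩ ⟨(hω : ω = ω₀), hx', (hQ : t x' + N ω + k'.1 = t x + N ω₀ + k.1)⟩
    subst hω
    refine ⟨rfl, by simpa using hx', ?_⟩
    rw [← hQ]
    abel
  · convert hshift k.1 (by simpa using hk) _
      (Finset.mem_image_of_mem _ (Finset.mem_univ (x, x'))) using 1
    abel
  · rintro ⟨⟨x', _⟩, k'⟩ ⟨rfl, -, (hk' : k'.1.1 = t x + N ω₀ + k.1 - N (w x) - t x')⟩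
    refine ⟨rfl, ?_⟩
    simp only [Q, hk']
    abel

end WorkExtraction

section Diagonalization

open Matrix

variable {X ι : Type*}

theorem submatrix_sigmaFiberEquiv [DecidableEq ι] {R : Type*} [Zero R] (c : X → ι)
    {A : Matrix X X R} (hc : ∀ x y, A x y ≠ 0 → c x = c y) :
    A.submatrix (Equiv.sigmaFiberEquiv c) (Equiv.sigmaFiberEquiv c) =
      blockDiagonal' fun k => A.submatrix (Subtype.val (p := (c · = k))) Subtype.val := by
  ext ⟨k, x⟩ ⟨l, y⟩
  obtain rfl | hkl := eq_or_ne k l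
  · rw [blockDiagonal'_apply_eq]
    rfl
  · rw [blockDiagonal'_apply_ne _ _ _ hkl]
    by_contra hA
    exact hkl (x.2.symm.trans ((hc _ _ hA).trans y.2))

theorem exists_unitary_diagonalizing_of_block [Fintype X] [DecidableEq X] [Finite ι] (c : X → ι)
    {A : Matrix X X ℂ} (hA : A.IsHermitian) (hc : ∀ x y, A x y ≠ 0 → c x = c y) :
    ∃ (U : Matrix X X ℂ) (l : X → ℝ), U ∈ unitaryGroup X ℂ ∧
      (∀ x y, U x y ≠ 0 → c x = c y) ∧ U * A * Uᴴ = diagonal fun x => (l x : ℂ) := by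
  classical
  cases nonempty_fintype ι
  let e := Equiv.sigmaFiberEquiv c
  have hblock (k : ι) := hA.submatrix (Subtype.val (p := (c · = k)))
  let V (k : ι) : Matrix {x // c x = k} {x // c x = k} ℂ := (hblock k).eigenvectorUnitary
  let l (p : Σ k, {x // c x = k}) : ℝ := (hblock p.1).eigenvalues p.2
  have hV (k : ι) : (V k)ᴴ * V k = 1 := mem_unitaryGroup_iff'.1 (hblock k).eigenvectorUnitary.2
  have hVA (k : ι) : (V k)ᴴ * A.submatrix Subtype.val Subtype.val * V k =
      diagonal fun x => (l ⟨k, x⟩ : ℂ) :=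
    (Unitary.conjStarAlgAut_star_apply _ _).symm.trans
      (hblock k).conjStarAlgAut_star_eigenvectorUnitary
  have hA' : A = (blockDiagonal' fun k => A.submatrix (Subtype.val (p := (c · = k)))
      Subtype.val).submatrix e.symm e.symm := by
    rw [← submatrix_sigmaFiberEquiv c hc, submatrix_submatrix, Equiv.self_comp_symm,
      submatrix_id_id]
  refine ⟨(blockDiagonal' fun k => (V k)ᴴ).submatrix e.symm e.symm, l ∘ e.symm, ?_,
    fun x y hxy => ?_, ?_⟩
  · rw [mem_unitaryGroup_iff, star_eq_conjTranspose, conjTranspose_submatrix, submatrix_mul_equiv,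
      blockDiagonal'_conjTranspose, ← blockDiagonal'_mul]
    simp only [conjTranspose_conjTranspose, hV]
    rw [← Pi.one_def, blockDiagonal'_one, submatrix_one_equiv]
  · by_contra hne
    exact hxy (blockDiagonal'_apply_ne (fun k => (V k)ᴴ) ⟨x, rfl⟩ ⟨y, rfl⟩ hne)
  · conv_lhs => rw [hA']
    rw [conjTranspose_submatrix, submatrix_mul_equiv, submatrix_mul_equiv,
      blockDiagonal'_conjTranspose, ← blockDiagonal'_mul, ← blockDiagonal'_mul]
    simp only [conjTranspose_conjTranspose, hVA]
    rw [blockDiagonal'_diagonal, submatrix_diagonal_equiv]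
    rfl

end Diagonalization

section SequenceType

variable {α : Type*} [Fintype α] [DecidableEq α] {n : ℕ}

/-- The type of a sequence: the number of occurrences of each letter. -/
def seqType (z : Fin n → α) (a : α) : Fin (n + 1) :=
  ⟨Finset.card {i | z i = a}, Nat.lt_succ_of_le (by simpa using Finset.card_le_univ {i | z i = a})⟩

/-- The type class of `T`: all sequences of type `T`. -/
def typeClass (T : α → Fin (n + 1)) : Finset (Fin n → α) := {z | seqType z = T}

/-- The joint type of two sequences: the number of occurrences of each pair of letters. -/
def jointType (x y : Fin n → α) : α × α → Fin (n + 1) := seqType fun i => (x i, y i)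

theorem prod_eq_prod_pow_seqType {M : Type*} [CommMonoid M] (f : α → M) (z : Fin n → α) :
    ∏ i, f (z i) = ∏ a, f a ^ (seqType z a : ℕ) := by
  simp [← Finset.prod_fiberwise' Finset.univ z f, seqType]

theorem copiesEnergy_eq_occEnergy (E : α → ℝ) (x : Fin n → α) :
    copiesEnergy E n x = occEnergy E fun a => ((seqType x a : ℕ) : ℤ) := by
  simp [copiesEnergy, occEnergy, seqType, ← Finset.sum_fiberwise' Finset.univ x E]

theorem seqType_eq_sum_jointType (x y : Fin n → α) (a : α) :
    (seqType x a : ℕ) = ∑ b, (jointType x y (a, b) : ℕ) := by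
  simp only [jointType, seqType, Prod.mk.injEq]
  rw [Finset.card_eq_sum_card_fiberwise (f := y) (t := Finset.univ) fun _ _ => Finset.mem_univ _]
  simp only [Finset.filter_filter]

theorem seqType_eq_of_jointType_eq {α : Type*} [Finite α] [DecidableEq α] {x x' y : Fin n → α}
    (h : jointType x y = jointType x' y) : seqType x = seqType x' := by
  cases nonempty_fintype α
  ext a
  rw [seqType_eq_sum_jointType x y, seqType_eq_sum_jointType x' y, h]

end SequenceType

section UniversalFactor

open Matrix

variable {α : Type*} [Fintype α] [DecidableEq α] {n : ℕ}

variable (α n) in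
/-- A matrix `F` such that the permutation-invariant operator `F Fᴴ` dominates all states `ρ^{⊗ n}`
up to a polynomial factor.  Its columns are, for each sequence `y` and each joint type `T`, the
normalised indicator of the `x` with joint type `T` with `y`. -/
def universalFactor : Matrix (Fin n → α) ((Fin n → α) × (α × α → Fin (n + 1))) ℂ :=
  fun x q => if jointType x q.1 = q.2 then ((√(typeClass q.2).card)⁻¹ : ℝ) else 0

theorem seqType_eq_of_universalFactor_ne_zero {x x' : Fin n → α}
    (h : (universalFactor α n * (universalFactor α n)ᴴ) x x' ≠ 0) : seqType x = seqType x' := by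
  obtain ⟨q, -, hq⟩ := Finset.exists_ne_zero_of_sum_ne_zero (mul_apply.symm.trans_ne h)
  simp only [universalFactor, conjTranspose_apply, ne_eq, mul_eq_zero, star_eq_zero, not_or,
    ite_eq_right_iff, not_forall] at hq
  obtain ⟨⟨hx, -⟩, hx', -⟩ := hq
  exact seqType_eq_of_jointType_eq (hx.trans hx'.symm)

theorem norm_sq_universalFactor (x : Fin n → α) (q : (Fin n → α) × (α × α → Fin (n + 1))) :
    ‖universalFactor α n x q‖ ^ 2 =
      if jointType x q.1 = q.2 then ((typeClass q.2).card : ℝ)⁻¹ else 0 := by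
  unfold universalFactor
  split_ifs
  · rw [Complex.norm_real, Real.norm_eq_abs, sq_abs, inv_pow, Real.sq_sqrt (Nat.cast_nonneg _)]
  · simp

theorem sum_norm_sq_universalFactor_le :
    ∑ x, ∑ q, ‖universalFactor α n x q‖ ^ 2 ≤
      ((n : ℝ) + 1) ^ (Fintype.card α * Fintype.card α) := by
  calc ∑ x, ∑ q, ‖universalFactor α n x q‖ ^ 2
      = ∑ p : (Fin n → α) × (Fin n → α), ∑ T,
          if jointType p.1 p.2 = T then ((typeClass T).card : ℝ)⁻¹ else 0 := by
        simp only [norm_sq_universalFactor, Fintype.sum_prod_type]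
    _ = ∑ z : Fin n → α × α, ∑ T, if seqType z = T then ((typeClass T).card : ℝ)⁻¹ else 0 :=
        Fintype.sum_equiv (Equiv.arrowProdEquivProdArrow _ _ _).symm _ _ fun _ => rfl
    _ = ∑ T : α × α → Fin (n + 1), ((typeClass T).card : ℝ) * ((typeClass T).card : ℝ)⁻¹ := by
        rw [Finset.sum_comm]
        simp only [← Finset.sum_filter, Finset.sum_const, nsmul_eq_mul, typeClass]
    _ ≤ ∑ _T : α × α → Fin (n + 1), 1 := Finset.sum_le_sum fun _ _ => mul_inv_le_one
    _ = _ := by simp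

theorem card_typeClass_mul_norm_sq_le {f : α → ℂ} (hf : ∑ a, ‖f a‖ ^ 2 = 1)
    (T : α → Fin (n + 1)) : (typeClass T).card * ‖∏ a, f a ^ (T a : ℕ)‖ ^ 2 ≤ 1 := by
  calc (typeClass T).card * ‖∏ a, f a ^ (T a : ℕ)‖ ^ 2
      = ∑ z ∈ typeClass T, ∏ i, ‖f (z i)‖ ^ 2 := by
        rw [← nsmul_eq_mul, ← Finset.sum_const]
        refine Finset.sum_congr rfl fun z hz => ?_
        rw [Finset.prod_pow, ← norm_prod, prod_eq_prod_pow_seqType f, (Finset.mem_filter.1 hz).2]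
    _ ≤ ∑ z : Fin n → α, ∏ i, ‖f (z i)‖ ^ 2 :=
        Finset.sum_le_univ_sum_of_nonneg fun z => by positivity
    _ = 1 := by rw [← Fintype.sum_pow fun a => ‖f a‖ ^ 2, hf, one_pow]

theorem vecMul_tensorPower (B : Matrix α α ℂ) (φ : (Fin n → α) → ℂ) (y : Fin n → α) :
    (φ ᵥ* tensorPower B n) y = ∑ T : α × α → Fin (n + 1),
      (∏ p : α × α, B p.1 p.2 ^ (T p : ℕ)) * ∑ x with jointType x y = T, φ x := by
  rw [vecMul, dotProduct, ← Finset.sum_fiberwise (s := Finset.univ) (g := (jointType · y))]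
  refine Finset.sum_congr rfl fun T _ => ?_
  rw [Finset.mul_sum]
  refine Finset.sum_congr rfl fun x hx => ?_
  rw [← (Finset.mem_filter.1 hx).2, mul_comm]
  exact congrArg (· * φ x)
    (prod_eq_prod_pow_seqType (fun p : α × α => B p.1 p.2) fun i => (x i, y i))

theorem norm_sq_prod_pow_mul_sum_le {B : Matrix α α ℂ} (hB : ∑ a, ∑ b, ‖B a b‖ ^ 2 = 1)
    (φ : (Fin n → α) → ℂ) (y : Fin n → α) (T : α × α → Fin (n + 1)) :
    ‖(∏ p : α × α, B p.1 p.2 ^ (T p : ℕ)) * ∑ x with jointType x y = T, φ x‖ ^ 2 ≤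
      ‖(φ ᵥ* universalFactor α n) (y, T)‖ ^ 2 := by
  have hF : (φ ᵥ* universalFactor α n) (y, T) =
      ((√(typeClass T).card)⁻¹ : ℝ) * ∑ x with jointType x y = T, φ x := by
    simp only [vecMul, dotProduct, universalFactor, mul_ite, mul_zero, ← Finset.sum_filter,
      ← Finset.sum_mul, mul_comm]
  obtain hempty | ⟨x, hx⟩ := Finset.eq_empty_or_nonempty {x | jointType x y = T}
  · simp [hempty]
  have hcard : 0 < ((typeClass T).card : ℝ) := by
    exact_mod_cast Finset.card_pos.2 ⟨_,
      Finset.mem_filter.2 ⟨Finset.mem_univ fun i => (x i, y i), (Finset.mem_filter.1 hx).2⟩⟩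
  rw [hF, norm_mul, norm_mul, mul_pow, mul_pow, Complex.norm_real, Real.norm_eq_abs, sq_abs,
    inv_pow, Real.sq_sqrt hcard.le]
  refine mul_le_mul_of_nonneg_right ?_ (sq_nonneg _)
  rw [← one_div, le_div_iff₀' hcard]
  exact card_typeClass_mul_norm_sq_le (f := fun p : α × α => B p.1 p.2)
    (by rw [Fintype.sum_prod_type, hB]) T

theorem norm_sq_vecMul_tensorPower_le {B : Matrix α α ℂ} (hB : ∑ a, ∑ b, ‖B a b‖ ^ 2 = 1)
    (φ : (Fin n → α) → ℂ) (y : Fin n → α) :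
    ‖(φ ᵥ* tensorPower B n) y‖ ^ 2 ≤ ((n : ℝ) + 1) ^ (Fintype.card α * Fintype.card α) *
      ∑ q, ‖(φ ᵥ* universalFactor α n) q‖ ^ 2 := by
  rw [vecMul_tensorPower]
  calc _ ≤ (∑ T : α × α → Fin (n + 1),
        ‖(∏ p : α × α, B p.1 p.2 ^ (T p : ℕ)) * ∑ x with jointType x y = T, φ x‖) ^ 2 :=
        pow_le_pow_left₀ (norm_nonneg _) (norm_sum_le _ _) 2
    _ ≤ ((n : ℝ) + 1) ^ (Fintype.card α * Fintype.card α) * ∑ T : α × α → Fin (n + 1),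
        ‖(∏ p : α × α, B p.1 p.2 ^ (T p : ℕ)) * ∑ x with jointType x y = T, φ x‖ ^ 2 :=
        sq_sum_le_card_mul_sum_sq.trans_eq (by simp)
    _ ≤ _ := by
        gcongr
        rw [Fintype.sum_prod_type]
        exact (Finset.sum_le_sum fun T _ => norm_sq_prod_pow_mul_sum_le hB φ y T).trans
          (Finset.single_le_sum (f := fun y => ∑ T, ‖(φ ᵥ* universalFactor α n) (y, T)‖ ^ 2)
            (fun _ _ => by positivity) (Finset.mem_univ y))

end UniversalFactor

section UniversalBasis

open Matrix

theorem sum_norm_sq_vecMul {X Q : Type*} [Fintype X] [DecidableEq X] [Fintype Q] {G : Matrix X Q ℂ}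
    {l : X → ℝ} (hG : G * Gᴴ = diagonal fun x => (l x : ℂ)) (a : X → ℂ) :
    ∑ q, ‖(a ᵥ* G) q‖ ^ 2 = ∑ x, l x * ‖a x‖ ^ 2 := by
  have h : a ᵥ* G ⬝ᵥ star (a ᵥ* G) = a ᵥ* (diagonal fun x => (l x : ℂ)) ⬝ᵥ star a := by
    rw [star_vecMul, dotProduct_mulVec, vecMul_vecMul, hG]
  simp only [vecMul_diagonal, dotProduct, Pi.star_apply, RCLike.star_def,
    mul_comm _ (Complex.ofReal (l _)), mul_assoc, Complex.mul_conj'] at h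
  exact_mod_cast h

theorem sum_norm_sq_unitary_mul {X Q : Type*} [Fintype X] [DecidableEq X] [Fintype Q]
    {U : Matrix X X ℂ} (hU : U ∈ unitaryGroup X ℂ) (F : Matrix X Q ℂ) :
    ∑ x, ∑ q, ‖(U * F) x q‖ ^ 2 = ∑ x, ∑ q, ‖F x q‖ ^ 2 := by
  have htrace (G : Matrix X Q ℂ) : ((∑ x, ∑ q, ‖G x q‖ ^ 2 : ℝ) : ℂ) = (Gᴴ * G).trace := by
    rw [trace_mul_comm]
    simp [trace, mul_apply, Complex.mul_conj']
  have h : (U * F)ᴴ * (U * F) = Fᴴ * F := by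
    rw [conjTranspose_mul, Matrix.mul_assoc, ← Matrix.mul_assoc Uᴴ, ← star_eq_conjTranspose U,
      mem_unitaryGroup_iff'.1 hU, Matrix.one_mul]
  exact_mod_cast (htrace _).trans (h ▸ (htrace F).symm)

variable {α : Type*} [Fintype α] [DecidableEq α] {n : ℕ}

/-- An orthonormal basis of the `n`-fold tensor power (the conjugated rows of `U`) made of vectors
of definite type, with weights `l` of polynomial total mass dominating all states `(B Bᴴ)^{⊗ n}`. -/
structure IsUniversalBasis (U : Matrix (Fin n → α) (Fin n → α) ℂ) (l : (Fin n → α) → ℝ) : Prop where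
  unitary : U ∈ unitaryGroup (Fin n → α) ℂ
  seqType_eq : ∀ x y, U x y ≠ 0 → seqType x = seqType y
  nonneg : ∀ x, 0 ≤ l x
  sum_le : ∑ x, l x ≤ ((n : ℝ) + 1) ^ (Fintype.card α * Fintype.card α)
  dominates : ∀ B : Matrix α α ℂ, ∑ a, ∑ b, ‖B a b‖ ^ 2 = 1 →
    ∀ (y : Fin n → α) (S : Finset (Fin n → α)),
      (∑ x ∈ S, ‖(U * tensorPower B n) x y‖ ^ 2) ^ 2 ≤
        ((n : ℝ) + 1) ^ (Fintype.card α * Fintype.card α) *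
          ∑ x ∈ S, l x * ‖(U * tensorPower B n) x y‖ ^ 2

theorem sq_sum_norm_sq_mul_tensorPower_le {U : Matrix (Fin n → α) (Fin n → α) ℂ}
    {l : (Fin n → α) → ℝ} (hUl : (U * universalFactor α n) * (U * universalFactor α n)ᴴ =
      diagonal fun x => (l x : ℂ)) {B : Matrix α α ℂ} (hB : ∑ a, ∑ b, ‖B a b‖ ^ 2 = 1)
    (y : Fin n → α) (S : Finset (Fin n → α)) :
    (∑ x ∈ S, ‖(U * tensorPower B n) x y‖ ^ 2) ^ 2 ≤
      ((n : ℝ) + 1) ^ (Fintype.card α * Fintype.card α) *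
        ∑ x ∈ S, l x * ‖(U * tensorPower B n) x y‖ ^ 2 := by
  set u := fun x => (U * tensorPower B n) x y
  let a : (Fin n → α) → ℂ := fun x => if x ∈ S then star (u x) else 0
  have hbound := norm_sq_vecMul_tensorPower_le hB (a ᵥ* U) y
  have hleft : (a ᵥ* (U * tensorPower B n)) y = ((∑ x ∈ S, ‖u x‖ ^ 2 : ℝ) : ℂ) := by
    simp [vecMul, dotProduct, a, u, Complex.conj_mul']
  have hright (x) : l x * ‖a x‖ ^ 2 = if x ∈ S then l x * ‖u x‖ ^ 2 else 0 := by
    by_cases hx : x ∈ S <;> simp [a, hx]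
  rw [vecMul_vecMul, vecMul_vecMul, sum_norm_sq_vecMul hUl, hleft, Complex.norm_real,
    Real.norm_eq_abs, sq_abs] at hbound
  simpa only [hright, Finset.sum_ite_mem, Finset.univ_inter] using hbound

variable (α n) in
theorem exists_isUniversalBasis :
    ∃ (U : Matrix (Fin n → α) (Fin n → α) ℂ) (l : (Fin n → α) → ℝ), IsUniversalBasis U l := by
  obtain ⟨U, l, hU, hblock, hdiag⟩ := exists_unitary_diagonalizing_of_block (seqType (α := α))
    (isHermitian_mul_conjTranspose_self (universalFactor α n))
    fun _ _ => seqType_eq_of_universalFactor_ne_zero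
  have hUl : (U * universalFactor α n) * (U * universalFactor α n)ᴴ =
      diagonal fun x => (l x : ℂ) := by
    rw [← hdiag, conjTranspose_mul]
    simp only [Matrix.mul_assoc]
  have hl (x) : l x = ∑ q, ‖(U * universalFactor α n) x q‖ ^ 2 := by
    simpa [Pi.single_apply, apply_ite] using (sum_norm_sq_vecMul hUl (Pi.single x 1)).symm
  refine ⟨U, l, hU, hblock, fun x => ?_, ?_, fun B hB => sq_sum_norm_sq_mul_tensorPower_le hUl hB⟩
  · rw [hl]
    positivity
  · simp only [hl]
    exact (sum_norm_sq_unitary_mul hU _).trans_le sum_norm_sq_universalFactor_le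

end UniversalBasis

section Concentration

variable {X J : Type*} {p : J → ℝ} {c : X → J → ℝ} {l : X → ℝ} {v s t : ℝ}

theorem sum_le_mul_of_sq_sum_le {a : X → ℝ} (ha : ∀ x, 0 ≤ a x) (hv : 0 ≤ v) (hs : 0 ≤ s)
    {S : Finset X} (hS : ∀ x ∈ S, l x ≤ s)
    (hdom : (∑ x ∈ S, a x) ^ 2 ≤ v * ∑ x ∈ S, l x * a x) : ∑ x ∈ S, a x ≤ v * s := by
  have hsq : (∑ x ∈ S, a x) * ∑ x ∈ S, a x ≤ v * s * ∑ x ∈ S, a x := by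
    rw [← pow_two, mul_assoc, Finset.mul_sum _ _ s]
    exact hdom.trans <| mul_le_mul_of_nonneg_left
      (Finset.sum_le_sum fun x hx => mul_le_mul_of_nonneg_right (hS x hx) (ha x)) hv
  rcases (Finset.sum_nonneg fun x (_ : x ∈ S) => ha x).eq_or_lt with h | h
  · rw [← h]
    positivity
  · exact le_of_mul_le_mul_right hsq h

variable [Fintype X] [Fintype J]

theorem sum_mixture_le_of_weight_le (hp : ∀ j, 0 ≤ p j) (hp1 : ∑ j, p j = 1)
    (hc : ∀ x j, 0 ≤ c x j) (hcol : ∀ j, ∑ x, c x j = 1) (hv : 0 ≤ v)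
    (hdom : ∀ j (S : Finset X), (∑ x ∈ S, p j * c x j) ^ 2 ≤ v * ∑ x ∈ S, l x * (p j * c x j))
    (hs : 0 ≤ s) (ht : 0 < t) {S : Finset X} (hS : ∀ x ∈ S, l x ≤ s) :
    ∑ x ∈ S, ∑ j, p j * c x j ≤ ∑ j with p j < t, p j + v * s / t := by
  have hpc (j x) : 0 ≤ p j * c x j := mul_nonneg (hp j) (hc x j)
  have hle (j) : ∑ x ∈ S, p j * c x j ≤ p j := by
    rw [← Finset.mul_sum]
    exact mul_le_of_le_one_right (hp j) <| (Finset.sum_le_sum_of_subset_of_nonneg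
      (Finset.subset_univ S) fun x _ _ => hc x j).trans_eq (hcol j)
  have hcolumn (j) : ∑ x ∈ S, p j * c x j ≤ (if p j < t then p j else 0) + v * s / t * p j := by
    split_ifs with h
    · have : 0 ≤ v * s / t * p j := mul_nonneg (by positivity) (hp j)
      linarith [hle j]
    · have hlarge : v * s ≤ v * s / t * p j := by
        rw [div_mul_eq_mul_div, le_div_iff₀ ht]
        exact mul_le_mul_of_nonneg_left (not_lt.1 h) (by positivity)
      linarith [sum_le_mul_of_sq_sum_le (hpc j) hv hs hS (hdom j S)]
  rw [Finset.sum_comm]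
  refine (Finset.sum_le_sum fun j _ => hcolumn j).trans_eq ?_
  rw [Finset.sum_add_distrib, ← Finset.mul_sum, hp1, mul_one, Finset.sum_filter]

theorem sum_mixture_le_of_le_weight (hp : ∀ j, 0 ≤ p j) (hc : ∀ x j, 0 ≤ c x j)
    (hcol : ∀ j, ∑ x, c x j = 1) (hrow : ∀ x, ∑ j, c x j = 1) (hl : ∀ x, 0 ≤ l x)
    (hlv : ∑ x, l x ≤ v) (hs : 0 < s) (ht : 0 ≤ t) {S : Finset X} (hS : ∀ x ∈ S, s ≤ l x) :
    ∑ x ∈ S, ∑ j, p j * c x j ≤ ∑ j with t < p j, p j + v * t / s := by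
  have hcard : (S.card : ℝ) ≤ v / s := by
    rw [le_div_iff₀ hs, ← nsmul_eq_mul]
    exact (Finset.card_nsmul_le_sum S l s hS).trans <|
      (Finset.sum_le_sum_of_subset_of_nonneg (Finset.subset_univ S) fun x _ _ => hl x).trans hlv
  set q : J → ℝ := fun j => if t < p j then p j else 0 with hq
  have hq₀ (j) : 0 ≤ q j := by
    simp only [hq]
    split_ifs
    exacts [hp j, le_rfl]
  have hpq (j) : p j ≤ q j + t := by
    simp only [hq]
    split_ifs with h
    exacts [le_add_of_nonneg_right ht, by linarith]
  calc ∑ x ∈ S, ∑ j, p j * c x j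
      ≤ ∑ x ∈ S, ∑ j, (q j * c x j + t * c x j) :=
        Finset.sum_le_sum fun x _ => Finset.sum_le_sum fun j _ =>
          (mul_le_mul_of_nonneg_right (hpq j) (hc x j)).trans_eq (add_mul _ _ _)
    _ = ∑ x ∈ S, ∑ j, q j * c x j + S.card * t := by
        simp only [Finset.sum_add_distrib, ← Finset.mul_sum, hrow, mul_one, Finset.sum_const,
          nsmul_eq_mul]
    _ ≤ ∑ x, ∑ j, q j * c x j + v / s * t :=
        add_le_add (Finset.sum_le_sum_of_subset_of_nonneg (Finset.subset_univ _) fun x _ _ =>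
          Finset.sum_nonneg fun j _ => mul_nonneg (hq₀ j) (hc x j))
          (mul_le_mul_of_nonneg_right hcard ht)
    _ = _ := by
        rw [Finset.sum_comm, div_mul_eq_mul_div, Finset.sum_filter]
        simp only [← Finset.mul_sum, hcol, mul_one, hq]

end Concentration

section LawOfLargeNumbers

variable {α : Type*} [Fintype α] {n : ℕ} {r : α → ℝ}

theorem sum_prod_mul_apply_mul_apply {g : α → ℝ} (hr : ∑ a, r a = 1) (hg : ∑ a, r a * g a = 0)
    (i j : Fin n) :
    ∑ x : Fin n → α, (∏ k, r (x k)) * (g (x i) * g (x j)) =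
      if i = j then ∑ a, r a * g a ^ 2 else 0 := by
  classical
  have hprod (x : Fin n → α) : (∏ k, r (x k)) * (g (x i) * g (x j)) =
      ∏ k, (r (x k) * ((if k = i then g (x k) else 1) * if k = j then g (x k) else 1)) := by
    rw [Finset.prod_mul_distrib, Finset.prod_mul_distrib]
    simp
  simp only [hprod]
  rw [← Fintype.piFinset_univ, ← Finset.prod_univ_sum (fun _ : Fin n => Finset.univ)
    fun k a => r a * ((if k = i then g a else 1) * if k = j then g a else 1)]
  split_ifs with hij
  · subst hij
    rw [Finset.prod_eq_single i (fun k _ hk => by simp [hk, hr]) (by simp)]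
    simp [pow_two]
  · exact Finset.prod_eq_zero (Finset.mem_univ i) (by simpa [hij] using hg)

theorem sum_prod_mul_sum_sq {g : α → ℝ} (hr : ∑ a, r a = 1) (hg : ∑ a, r a * g a = 0) :
    ∑ x : Fin n → α, (∏ k, r (x k)) * (∑ k, g (x k)) ^ 2 = n * ∑ a, r a * g a ^ 2 := by
  simp only [pow_two (∑ _, g _), Finset.sum_mul_sum, Finset.mul_sum Finset.univ _ (∏ _, r _)]
  rw [Finset.sum_comm]
  simp_rw [Finset.sum_comm (s := (Finset.univ : Finset (Fin n → α))),
    sum_prod_mul_apply_mul_apply hr hg]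
  simp

/-- The variance of `f` under the probability weights `r`. -/
def weightedVariance (r f : α → ℝ) : ℝ := ∑ a, r a * (f a - ∑ b, r b * f b) ^ 2

theorem sum_prod_deviation_le (hr₀ : ∀ a, 0 ≤ r a) (hr : ∑ a, r a = 1) (f : α → ℝ) {δ : ℝ}
    (hn : 0 < n) (hδ : 0 < δ) :
    ∑ x : Fin n → α with n * δ ≤ |∑ k, f (x k) - n * ∑ a, r a * f a|, ∏ k, r (x k) ≤
      weightedVariance r f / (n * δ ^ 2) := by
  set μ := ∑ a, r a * f a with hμ
  have hcentered : ∑ a, r a * (f a - μ) = 0 := by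
    simp only [mul_sub, Finset.sum_sub_distrib, ← Finset.sum_mul, hr, one_mul, ← hμ, sub_self]
  have hprod (x : Fin n → α) : 0 ≤ ∏ k, r (x k) := Finset.prod_nonneg fun k _ => hr₀ _
  have hpos : 0 < n * δ := by positivity
  have hchebyshev : (∑ x : Fin n → α with n * δ ≤ |∑ k, f (x k) - n * μ|, ∏ k, r (x k)) *
      (n * δ) ^ 2 ≤ n * weightedVariance r f := by
    rw [weightedVariance, ← sum_prod_mul_sum_sq hr hcentered, Finset.sum_mul]
    refine (Finset.sum_le_sum fun x hx => mul_le_mul_of_nonneg_left ?_ (hprod x)).trans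
      (Finset.sum_le_sum_of_subset_of_nonneg (Finset.subset_univ _) fun x _ _ =>
        mul_nonneg (hprod x) (sq_nonneg _))
    rw [Finset.sum_sub_distrib, Finset.sum_const, Finset.card_univ, Fintype.card_fin,
      nsmul_eq_mul, ← sq_abs (_ - _)]
    exact pow_le_pow_left₀ hpos.le (Finset.mem_filter.1 hx).2 2
  refine ((le_div_iff₀ (by positivity)).2 hchebyshev).trans_eq ?_
  field_simp

theorem sum_prod_atypical_le (hr₀ : ∀ a, 0 ≤ r a) (hr : ∑ a, r a = 1) {δ : ℝ} (hn : 0 < n)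
    (hδ : 0 < δ) {S : Finset (Fin n → α)}
    (hS : ∀ x ∈ S, 0 < ∏ k, r (x k) →
      n * δ ≤ |Real.log (∏ k, r (x k)) + n * ∑ a, Real.negMulLog (r a)|) :
    ∑ x ∈ S, ∏ k, r (x k) ≤ weightedVariance r (fun a => Real.log (r a)) / (n * δ ^ 2) := by
  have hprod (x : Fin n → α) : 0 ≤ ∏ k, r (x k) := Finset.prod_nonneg fun k _ => hr₀ _
  have hmean : ∑ a, Real.negMulLog (r a) = -∑ a, r a * Real.log (r a) := by
    simp [Real.negMulLog]
  refine le_trans ?_ (sum_prod_deviation_le hr₀ hr (fun a => Real.log (r a)) hn hδ)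
  rw [← Finset.sum_filter_ne_zero]
  refine Finset.sum_le_sum_of_subset_of_nonneg (fun x hx => ?_) fun x _ _ => hprod x
  obtain ⟨hxS, hx₀⟩ := Finset.mem_filter.1 hx
  have hx := hS x hxS ((hprod x).lt_of_ne' hx₀)
  rw [Real.log_prod fun k hk => Finset.prod_ne_zero_iff.1 hx₀ k hk, hmean, mul_neg,
    ← sub_eq_add_neg] at hx
  exact Finset.mem_filter.2 ⟨Finset.mem_univ x, hx⟩

end LawOfLargeNumbers

section TensorPower

variable {α : Type*} {n : ℕ}

theorem tensorPower_mul [Fintype α] (A B : Matrix α α ℂ) :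
    tensorPower (A * B) n = tensorPower A n * tensorPower B n := by
  classical
  ext x y
  simp only [tensorPower, Matrix.mul_apply, Finset.prod_univ_sum, Fintype.piFinset_univ,
    Finset.prod_mul_distrib]

theorem tensorPower_conjTranspose (A : Matrix α α ℂ) :
    tensorPower A.conjTranspose n = (tensorPower A n).conjTranspose := by
  ext x y
  simp [tensorPower, Matrix.conjTranspose_apply, star_prod]

theorem tensorPower_diagonal [DecidableEq α] (a : α → ℂ) :
    tensorPower (Matrix.diagonal a) n = Matrix.diagonal fun x : Fin n → α => ∏ i, a (x i) := by
  ext x y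
  simp only [tensorPower, Matrix.diagonal_apply]
  split_ifs with h
  · subst h; simp
  · obtain ⟨i, hi⟩ := Function.ne_iff.1 h
    exact Finset.prod_eq_zero (Finset.mem_univ i) (if_neg hi)

theorem tensorPower_mem_unitaryGroup [Fintype α] [DecidableEq α] {V : Matrix α α ℂ}
    (hV : V ∈ Matrix.unitaryGroup α ℂ) :
    tensorPower V n ∈ Matrix.unitaryGroup (Fin n → α) ℂ := by
  rw [Matrix.mem_unitaryGroup_iff, Matrix.star_eq_conjTranspose, ← tensorPower_conjTranspose,
    ← tensorPower_mul, ← Matrix.star_eq_conjTranspose, Matrix.mem_unitaryGroup_iff.1 hV,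
    ← Matrix.diagonal_one, tensorPower_diagonal]
  simp

end TensorPower

section Spectral

open Matrix

variable {α : Type*} [Fintype α] [DecidableEq α]

theorem sum_norm_sq_row {V : Matrix α α ℂ} (hV : V ∈ unitaryGroup α ℂ) (i : α) :
    ∑ j, ‖V i j‖ ^ 2 = 1 := by
  have h := congrFun (congrFun (mem_unitaryGroup_iff.1 hV) i) i
  simp only [mul_apply, star_apply, RCLike.star_def, Complex.mul_conj', one_apply_eq] at h
  exact_mod_cast h

theorem sum_norm_sq_col {V : Matrix α α ℂ} (hV : V ∈ unitaryGroup α ℂ) (j : α) :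
    ∑ i, ‖V i j‖ ^ 2 = 1 := by
  simpa [star_apply] using sum_norm_sq_row (Unitary.star_mem hV) j

theorem eq_mul_diagonal_mul {A : Matrix α α ℂ} (hA : A.IsHermitian) :
    A = (hA.eigenvectorUnitary : Matrix α α ℂ) * diagonal (fun i => (hA.eigenvalues i : ℂ)) *
      (hA.eigenvectorUnitary : Matrix α α ℂ)ᴴ := by
  conv_lhs => rw [hA.spectral_theorem, Unitary.conjStarAlgAut_apply]
  rfl

theorem cfc_eq_mul_diagonal_mul {A : Matrix α α ℂ} (hA : A.IsHermitian) (f : ℝ → ℝ) :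
    cfc f A = (hA.eigenvectorUnitary : Matrix α α ℂ) *
      diagonal (fun i => (f (hA.eigenvalues i) : ℂ)) *
      (hA.eigenvectorUnitary : Matrix α α ℂ)ᴴ := by
  rw [hA.cfc_eq, IsHermitian.cfc, Unitary.conjStarAlgAut_apply]
  rfl

theorem trace_cfc {A : Matrix α α ℂ} (hA : A.IsHermitian) (f : ℝ → ℝ) :
    (cfc f A).trace = ∑ i, (f (hA.eigenvalues i) : ℂ) := by
  rw [cfc_eq_mul_diagonal_mul hA, trace_mul_cycle, ← star_eq_conjTranspose,
    mem_unitaryGroup_iff'.1 hA.eigenvectorUnitary.2, Matrix.one_mul, trace_diagonal]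

theorem cfc_diagonal (f : ℝ → ℝ) (g : α → ℝ) :
    cfc f (diagonal fun i => (g i : ℂ)) = diagonal fun i => (f (g i) : ℂ) := by
  have hA : (diagonal fun i => (g i : ℂ)).IsHermitian :=
    isHermitian_diagonal_of_self_adjoint _ (by ext i; simp)
  set V := (hA.eigenvectorUnitary : Matrix α α ℂ) with hV
  have hVV : V * Vᴴ = 1 := mem_unitaryGroup_iff.1 hA.eigenvectorUnitary.2
  have hVV' : Vᴴ * V = 1 := mem_unitaryGroup_iff'.1 hA.eigenvectorUnitary.2
  have heigen : (diagonal fun i => (g i : ℂ)) * V =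
      V * diagonal (fun i => (hA.eigenvalues i : ℂ)) := by
    conv_lhs => rw [eq_mul_diagonal_mul hA]
    rw [← hV, Matrix.mul_assoc, hVV', Matrix.mul_one]
  have hfeigen : (diagonal fun i => (f (g i) : ℂ)) * V =
      V * diagonal (fun i => (f (hA.eigenvalues i) : ℂ)) := by
    ext i j
    have hij := congrFun (congrFun heigen i) j
    rw [diagonal_mul, mul_diagonal, mul_comm] at hij ⊢
    by_cases hVij : V i j = 0
    · simp [hVij]
    · rw [Complex.ofReal_injective (mul_left_cancel₀ hVij hij)]
  rw [cfc_eq_mul_diagonal_mul hA, ← hV, ← hfeigen, Matrix.mul_assoc, hVV, Matrix.mul_one]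

theorem rotatedWeight_mul_diagonal_mul (U V : Matrix α α ℂ) (p : α → ℝ) (x : α) :
    rotatedWeight U (V * diagonal (fun j => (p j : ℂ)) * Vᴴ) x =
      ∑ j, p j * ‖(U * V) x j‖ ^ 2 := by
  have h : (U * (V * diagonal (fun j => (p j : ℂ)) * Vᴴ) * Uᴴ) x x =
      ((∑ j, p j * ‖(U * V) x j‖ ^ 2 : ℝ) : ℂ) := by
    rw [← Matrix.mul_assoc, ← Matrix.mul_assoc, Matrix.mul_assoc _ Vᴴ, ← conjTranspose_mul,
      mul_apply]
    push_cast
    refine Finset.sum_congr rfl fun j _ => ?_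
    rw [mul_diagonal, conjTranspose_apply, ← Complex.mul_conj', RCLike.star_def]
    ring
  rw [rotatedWeight, h, Complex.ofReal_re]

theorem re_apply_self_eq_sum {A : Matrix α α ℂ} (hA : A.IsHermitian) (i : α) :
    (A i i).re = ∑ j, hA.eigenvalues j * ‖(hA.eigenvectorUnitary : Matrix α α ℂ) i j‖ ^ 2 := by
  have h := rotatedWeight_mul_diagonal_mul 1 hA.eigenvectorUnitary hA.eigenvalues i
  rwa [← eq_mul_diagonal_mul hA, rotatedWeight, Matrix.one_mul, Matrix.one_mul,
    conjTranspose_one, Matrix.mul_one] at h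

end Spectral

section Density

variable {α : Type*} {ρ : Matrix α α ℂ}

theorem IsDensity.re_apply_self_nonneg (hρ : IsDensity ρ) (i : α) : 0 ≤ (ρ i i).re :=
  (Complex.le_def.1 (hρ.1.diag_nonneg (i := i))).1

theorem IsDensity.ofReal_re_apply_self (hρ : IsDensity ρ) (i : α) : ((ρ i i).re : ℂ) = ρ i i :=
  hρ.1.1.coe_re_apply_self i

theorem IsDensity.nonempty (hρ : IsDensity ρ) : Nonempty α := by
  by_contra h
  rw [not_nonempty_iff] at h
  exact zero_ne_one (hasSum_empty.unique hρ.2)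

variable [Fintype α]

theorem IsDensity.trace_eq_one (hρ : IsDensity ρ) : ρ.trace = 1 :=
  (hasSum_fintype _).unique hρ.2

theorem IsDensity.sum_re_apply_self (hρ : IsDensity ρ) : ∑ i, (ρ i i).re = 1 := by
  rw [← Complex.re_sum]
  exact congrArg Complex.re hρ.trace_eq_one

theorem IsDensity.sum_eigenvalues [DecidableEq α] (hρ : IsDensity ρ) :
    ∑ j, hρ.1.1.eigenvalues j = 1 := by
  have h := hρ.1.1.trace_eq_sum_eigenvalues.symm.trans hρ.trace_eq_one
  rw [← RCLike.ofReal_sum] at h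
  exact RCLike.ofReal_injective (h.trans RCLike.ofReal_one.symm)

end Density

section Entropy

open Matrix

theorem sub_le_mul_log_sub_log {p g : ℝ} (hp : 0 ≤ p) (hg : 0 < g) :
    p - g ≤ p * (Real.log p - Real.log g) := by
  rcases hp.eq_or_lt with rfl | hp
  · simpa using hg.le
  · have h := mul_le_mul_of_nonneg_left (Real.one_sub_inv_le_log_of_pos (div_pos hp hg)) hp.le
    rw [Real.log_div hp.ne' hg.ne', inv_div, mul_sub, mul_one, mul_div_cancel₀ _ hp.ne'] at h
    exact h

variable {α : Type*} [Fintype α]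

theorem sum_sum_mul_log_nonneg {c : α → α → ℝ} {p g : α → ℝ} (hc : ∀ i j, 0 ≤ c i j)
    (hrow : ∀ i, ∑ j, c i j = 1) (hcol : ∀ j, ∑ i, c i j = 1) (hp : ∀ j, 0 ≤ p j)
    (hg : ∀ i, 0 < g i) (hpg : ∑ i, g i ≤ ∑ j, p j) :
    0 ≤ ∑ i, ∑ j, c i j * (p j * (Real.log (p j) - Real.log (g i))) := by
  have hsum : ∑ i, ∑ j, c i j * (p j - g i) = ∑ j, p j - ∑ i, g i := by
    simp only [mul_sub, Finset.sum_sub_distrib]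
    rw [Finset.sum_comm]
    simp only [← Finset.sum_mul, hrow, hcol, one_mul]
  exact ((sub_nonneg.2 hpg).trans_eq hsum.symm).trans <|
    Finset.sum_le_sum fun i _ => Finset.sum_le_sum fun j _ =>
      mul_le_mul_of_nonneg_left (sub_le_mul_log_sub_log (hp j) (hg i)) (hc i j)

/-- The mean energy `Tr ρH`. -/
def meanEnergy (E : α → ℝ) (ρ : Matrix α α ℂ) : ℝ := ∑ i, (ρ i i).re * E i

/-- The von Neumann entropy `-Tr ρ log ρ`, in terms of the eigenvalues of `ρ`. -/
def eigenEntropy [DecidableEq α] {ρ : Matrix α α ℂ} (h : ρ.IsHermitian) : ℝ :=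
  ∑ j, Real.negMulLog (h.eigenvalues j)

variable {d : ℕ} {ρ : Matrix (Fin d) (Fin d) ℂ}

theorem relEntropy_gibbs_eq_sub (β : ℝ) (E : Fin d → ℝ) (hρ : IsDensity ρ) :
    relEntropy ρ (gibbs β E) =
      -eigenEntropy hρ.1.1 - ∑ i, (ρ i i).re * Real.log (gibbsWeight β E i) := by
  have hρlog : (ρ * cfc Real.log ρ).trace = ((-eigenEntropy hρ.1.1 : ℝ) : ℂ) := by
    have hcont (f : ℝ → ℝ) : ContinuousOn f (spectrum ℝ ρ) := finite_real_spectrum.continuousOn f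
    have hcfc : ρ * cfc Real.log ρ = cfc (fun x => x * Real.log x) ρ := by
      conv_lhs => enter [1]; rw [← cfc_id' ℝ ρ hρ.1.1]
      exact (cfc_mul _ _ ρ (hcont _) (hcont _)).symm
    rw [hcfc, trace_cfc hρ.1.1]
    simp [eigenEntropy, Real.negMulLog]
  have hgibbs : (ρ * cfc Real.log (gibbs β E)).trace =
      ((∑ i, (ρ i i).re * Real.log (gibbsWeight β E i) : ℝ) : ℂ) := by
    rw [gibbs_eq_diagonal, cfc_diagonal, trace]
    push_cast
    exact Finset.sum_congr rfl fun i _ => by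
      rw [diag_apply, mul_diagonal, hρ.ofReal_re_apply_self]
  rw [relEntropy, trace_sub, hρlog, hgibbs, Complex.sub_re, Complex.ofReal_re, Complex.ofReal_re]

theorem relEntropy_gibbs (β : ℝ) (E : Fin d → ℝ) (hρ : IsDensity ρ) :
    relEntropy ρ (gibbs β E) =
      β * meanEnergy E ρ + Real.log (partitionFn β E) - eigenEntropy hρ.1.1 := by
  have := hρ.nonempty
  have hsum : ∑ i, (ρ i i).re * (-β * E i) = -(β * meanEnergy E ρ) := by
    rw [meanEnergy, Finset.mul_sum, ← Finset.sum_neg_distrib]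
    exact Finset.sum_congr rfl fun i _ => by ring
  simp only [relEntropy_gibbs_eq_sub β E hρ, log_gibbsWeight, mul_sub, Finset.sum_sub_distrib,
    hsum, ← Finset.sum_mul, hρ.sum_re_apply_self, one_mul]
  ring

theorem relEntropy_gibbs_nonneg (β : ℝ) (E : Fin d → ℝ) (hρ : IsDensity ρ) :
    0 ≤ relEntropy ρ (gibbs β E) := by
  have := hρ.nonempty
  set V := (hρ.1.1.eigenvectorUnitary : Matrix (Fin d) (Fin d) ℂ)
  have hV : V ∈ unitaryGroup (Fin d) ℂ := hρ.1.1.eigenvectorUnitary.2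
  refine (sum_sum_mul_log_nonneg (c := fun i j => ‖V i j‖ ^ 2) (fun i j => sq_nonneg _)
    (sum_norm_sq_row hV) (sum_norm_sq_col hV) hρ.1.eigenvalues_nonneg (gibbsWeight_pos β E)
    (by rw [sum_gibbsWeight, hρ.sum_eigenvalues])).trans_eq ?_
  simp only [relEntropy_gibbs_eq_sub β E hρ, mul_sub, Finset.sum_sub_distrib]
  congr 1
  · rw [Finset.sum_comm]
    simp [← Finset.sum_mul, sum_norm_sq_col hV, eigenEntropy, Real.negMulLog]
  · refine Finset.sum_congr rfl fun i _ => ?_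
    rw [re_apply_self_eq_sum hρ.1.1, Finset.sum_mul]
    exact Finset.sum_congr rfl fun j _ => by ring

end Entropy

section StateConcentration

open Matrix

variable {α : Type*} [Fintype α] [DecidableEq α] {n : ℕ}
  {U : Matrix (Fin n → α) (Fin n → α) ℂ} {l : (Fin n → α) → ℝ} {ρ : Matrix α α ℂ}

/-- The squared overlaps of the rows of `U` with the product eigenvectors of `ρ^{⊗ n}`. -/
def overlap (U : Matrix (Fin n → α) (Fin n → α) ℂ) (h : ρ.IsHermitian) (x j : Fin n → α) : ℝ :=
  ‖(U * tensorPower (h.eigenvectorUnitary : Matrix α α ℂ) n) x j‖ ^ 2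

theorem overlap_nonneg (h : ρ.IsHermitian) (x j : Fin n → α) : 0 ≤ overlap U h x j :=
  sq_nonneg _

theorem mul_tensorPower_eigenvectorUnitary_mem (hU : U ∈ unitaryGroup (Fin n → α) ℂ)
    (h : ρ.IsHermitian) :
    U * tensorPower (h.eigenvectorUnitary : Matrix α α ℂ) n ∈ unitaryGroup (Fin n → α) ℂ :=
  mul_mem hU (tensorPower_mem_unitaryGroup h.eigenvectorUnitary.2)

theorem rotatedWeight_tensorPower (U : Matrix (Fin n → α) (Fin n → α) ℂ) (h : ρ.IsHermitian)
    (x : Fin n → α) :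
    rotatedWeight U (tensorPower ρ n) x = ∑ j, (∏ i, h.eigenvalues (j i)) * overlap U h x j := by
  simp only [overlap, ← rotatedWeight_mul_diagonal_mul]
  conv_lhs => rw [eq_mul_diagonal_mul h]
  simp only [tensorPower_mul, tensorPower_conjTranspose, tensorPower_diagonal, Complex.ofReal_prod]

theorem posSemidef_tensorPower {α : Type*} [Finite α] {ρ : Matrix α α ℂ} (hρ : ρ.PosSemidef)
    (n : ℕ) : (tensorPower ρ n).PosSemidef := by
  classical
  cases nonempty_fintype α
  rw [eq_mul_diagonal_mul hρ.1]
  simp only [tensorPower_mul, tensorPower_conjTranspose, tensorPower_diagonal]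
  refine Matrix.PosSemidef.mul_mul_conjTranspose_same (Matrix.PosSemidef.diagonal fun x => ?_) _
  exact Finset.prod_nonneg fun i _ => Complex.zero_le_real.2 (hρ.eigenvalues_nonneg _)

theorem IsDensity.sum_rotatedWeight_tensorPower (hρ : IsDensity ρ)
    (hU : U ∈ unitaryGroup (Fin n → α) ℂ) : ∑ x, rotatedWeight U (tensorPower ρ n) x = 1 := by
  have htrace : (tensorPower ρ n).trace = 1 := by
    rw [← one_pow n, ← hρ.trace_eq_one, trace, trace, Fintype.sum_pow]
    rfl
  rw [sum_rotatedWeight hU, htrace, Complex.one_re]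

theorem IsDensity.prod_eigenvalues_nonneg (hρ : IsDensity ρ) (j : Fin n → α) :
    0 ≤ ∏ i, hρ.1.1.eigenvalues (j i) :=
  Finset.prod_nonneg fun _ _ => hρ.1.eigenvalues_nonneg _

theorem IsDensity.sum_prod_eigenvalues (hρ : IsDensity ρ) :
    ∑ j : Fin n → α, ∏ i, hρ.1.1.eigenvalues (j i) = 1 := by
  rw [← Fintype.sum_pow, hρ.sum_eigenvalues, one_pow]

/-- The universal basis dominates `ρ^{⊗ n}`, seen by taking `B = √ρ` up to a unitary. -/
theorem IsUniversalBasis.sq_sum_overlap_le (hU : IsUniversalBasis U l) (hρ : IsDensity ρ)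
    (j : Fin n → α) (S : Finset (Fin n → α)) :
    (∑ x ∈ S, (∏ i, hρ.1.1.eigenvalues (j i)) * overlap U hρ.1.1 x j) ^ 2 ≤
      ((n : ℝ) + 1) ^ (Fintype.card α * Fintype.card α) *
        ∑ x ∈ S, l x * ((∏ i, hρ.1.1.eigenvalues (j i)) * overlap U hρ.1.1 x j) := by
  set p := hρ.1.1.eigenvalues
  set V := (hρ.1.1.eigenvectorUnitary : Matrix α α ℂ) with hV
  set B := V * diagonal (fun i => (√(p i) : ℂ)) with hB
  have hsqrt (a) : ‖(√(p a) : ℂ)‖ ^ 2 = p a := by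
    rw [Complex.norm_real, Real.norm_eq_abs, sq_abs, Real.sq_sqrt (hρ.1.eigenvalues_nonneg a)]
  have hB1 : ∑ a, ∑ b, ‖B a b‖ ^ 2 = 1 := by
    simp only [hB, mul_diagonal, norm_mul, mul_pow, hsqrt]
    rw [Finset.sum_comm]
    simp only [← Finset.sum_mul, hV, sum_norm_sq_col hρ.1.1.eigenvectorUnitary.2, one_mul]
    exact hρ.sum_eigenvalues
  have hoverlap (x) :
      ‖(U * tensorPower B n) x j‖ ^ 2 = (∏ i, p (j i)) * overlap U hρ.1.1 x j := by
    rw [hB, tensorPower_mul, tensorPower_diagonal, ← Matrix.mul_assoc, mul_diagonal, norm_mul,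
      mul_pow, mul_comm, overlap, norm_prod, ← Finset.prod_pow]
    simp only [hsqrt, hV]
  simpa only [hoverlap] using hU.dominates B hB1 j S

theorem sum_rotatedWeight_eq_of_invariant {X : Type*} [Fintype X] [DecidableEq X]
    {U : Matrix X X ℂ} (hU : U ∈ unitaryGroup X ℂ) {P : X → Prop} [DecidablePred P]
    (hP : ∀ x y, U x y ≠ 0 → (P x ↔ P y)) (A : Matrix X X ℂ) :
    ∑ x with P x, rotatedWeight U A x = ∑ x with P x, (A x x).re := by
  set D : Matrix X X ℂ := diagonal fun x => if P x then 1 else 0 with hD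
  have hcomm : D * U = U * D := by
    ext x y
    rw [hD, diagonal_mul, mul_diagonal]
    by_cases hxy : U x y = 0
    · simp [hxy]
    · rw [mul_comm]
      simp only [hP x y hxy]
  have htrace : trace (D * (U * A * Uᴴ)) = trace (D * A) := by
    rw [← Matrix.mul_assoc, trace_mul_comm, ← Matrix.mul_assoc D, hcomm, Matrix.mul_assoc,
      ← Matrix.mul_assoc Uᴴ, ← star_eq_conjTranspose, mem_unitaryGroup_iff'.1 hU, Matrix.one_mul]
  simpa [trace, hD, diagonal_mul, Complex.re_sum, Finset.sum_filter, rotatedWeight, apply_ite]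
    using congrArg Complex.re htrace

/-- The logarithm of the ratio of the weight `l x` to the Gibbs weight of `x`.  On the outcome `x`,
`β⁻¹` times this amount of work is extracted, up to rounding. -/
def workScore (β : ℝ) (E : α → ℝ) (l : (Fin n → α) → ℝ) (x : Fin n → α) : ℝ :=
  β * copiesEnergy E n x + Real.log (l x) + n * Real.log (partitionFn β E)

/-- The variance constant of the concentration of `workScore`. -/
def scoreVariance (E : α → ℝ) (hρ : IsDensity ρ) : ℝ :=
  2 * weightedVariance hρ.1.1.eigenvalues (fun a => Real.log (hρ.1.1.eigenvalues a)) +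
    weightedVariance (fun a => (ρ a a).re) E

theorem IsUniversalBasis.sum_rotatedWeight_small_le (hU : IsUniversalBasis U l) (hρ : IsDensity ρ)
    {δ : ℝ} (hn : 0 < n) (hδ : 0 < δ) :
    ∑ x with l x ≤ Real.exp (-(n * (eigenEntropy hρ.1.1 + 2 * δ))),
        rotatedWeight U (tensorPower ρ n) x ≤
      weightedVariance hρ.1.1.eigenvalues (fun a => Real.log (hρ.1.1.eigenvalues a)) / (n * δ ^ 2) +
        ((n : ℝ) + 1) ^ (Fintype.card α * Fintype.card α) * Real.exp (-(n * δ)) := by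
  set s := eigenEntropy hρ.1.1 with hs
  simp only [rotatedWeight_tensorPower U hρ.1.1]
  refine (sum_mixture_le_of_weight_le (t := Real.exp (-(n * (s + δ)))) hρ.prod_eigenvalues_nonneg
    hρ.sum_prod_eigenvalues (overlap_nonneg hρ.1.1)
    (sum_norm_sq_col (mul_tensorPower_eigenvectorUnitary_mem hU.unitary hρ.1.1)) (by positivity)
    (hU.sq_sum_overlap_le hρ) (Real.exp_pos _).le (Real.exp_pos _)
    fun x hx => (Finset.mem_filter.1 hx).2).trans (add_le_add ?_ (le_of_eq ?_))
  · refine sum_prod_atypical_le hρ.1.eigenvalues_nonneg hρ.sum_eigenvalues hn hδ fun j hj hpos => ?_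
    have hlog := (Real.log_lt_iff_lt_exp hpos).2 (Finset.mem_filter.1 hj).2
    refine le_abs.2 (Or.inr ?_)
    rw [hs, eigenEntropy] at hlog
    linarith
  · rw [mul_div_assoc, ← Real.exp_sub]
    congr 2
    ring

theorem IsUniversalBasis.sum_rotatedWeight_large_le (hU : IsUniversalBasis U l) (hρ : IsDensity ρ)
    {δ : ℝ} (hn : 0 < n) (hδ : 0 < δ) :
    ∑ x with Real.exp (-(n * (eigenEntropy hρ.1.1 - 2 * δ))) ≤ l x,
        rotatedWeight U (tensorPower ρ n) x ≤
      weightedVariance hρ.1.1.eigenvalues (fun a => Real.log (hρ.1.1.eigenvalues a)) / (n * δ ^ 2) +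
        ((n : ℝ) + 1) ^ (Fintype.card α * Fintype.card α) * Real.exp (-(n * δ)) := by
  set s := eigenEntropy hρ.1.1 with hs
  have hQ := mul_tensorPower_eigenvectorUnitary_mem hU.unitary hρ.1.1
  simp only [rotatedWeight_tensorPower U hρ.1.1]
  refine (sum_mixture_le_of_le_weight (t := Real.exp (-(n * (s - δ)))) hρ.prod_eigenvalues_nonneg
    (overlap_nonneg hρ.1.1) (sum_norm_sq_col hQ) (sum_norm_sq_row hQ) hU.nonneg hU.sum_le
    (Real.exp_pos _) (Real.exp_pos _).le
    fun x hx => (Finset.mem_filter.1 hx).2).trans (add_le_add ?_ (le_of_eq ?_))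
  · refine sum_prod_atypical_le hρ.1.eigenvalues_nonneg hρ.sum_eigenvalues hn hδ fun j hj hpos => ?_
    have hlog := (Real.lt_log_iff_exp_lt hpos).2 (Finset.mem_filter.1 hj).2
    refine le_abs.2 (Or.inl ?_)
    rw [hs, eigenEntropy] at hlog
    linarith
  · rw [mul_div_assoc, ← Real.exp_sub]
    congr 2
    ring

theorem IsUniversalBasis.sum_rotatedWeight_energy_le (hU : IsUniversalBasis U l)
    (hρ : IsDensity ρ) (E : α → ℝ) {δ : ℝ} (hn : 0 < n) (hδ : 0 < δ) :
    ∑ x with n * δ ≤ |copiesEnergy E n x - n * meanEnergy E ρ|,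
        rotatedWeight U (tensorPower ρ n) x ≤
      weightedVariance (fun a => (ρ a a).re) E / (n * δ ^ 2) := by
  have hinvariant (x y) (hxy : U x y ≠ 0) : n * δ ≤ |copiesEnergy E n x - n * meanEnergy E ρ| ↔
      n * δ ≤ |copiesEnergy E n y - n * meanEnergy E ρ| := by
    rw [copiesEnergy_eq_occEnergy, copiesEnergy_eq_occEnergy, hU.seqType_eq x y hxy]
  have hdiag (x : Fin n → α) : (tensorPower ρ n x x).re = ∏ i, (ρ (x i) (x i)).re := by
    rw [tensorPower, ← Complex.ofReal_re (∏ i, (ρ (x i) (x i)).re)]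
    simp only [Complex.ofReal_prod, hρ.ofReal_re_apply_self]
  rw [sum_rotatedWeight_eq_of_invariant hU.unitary hinvariant]
  simp only [hdiag]
  exact sum_prod_deviation_le hρ.re_apply_self_nonneg hρ.sum_re_apply_self E hn hδ

theorem sum_union_le_of_nonneg {X : Type*} [DecidableEq X] {f : X → ℝ} (hf : ∀ x, 0 ≤ f x)
    (s t : Finset X) : ∑ x ∈ s ∪ t, f x ≤ ∑ x ∈ s, f x + ∑ x ∈ t, f x := by
  rw [← Finset.sum_union_inter]
  exact le_add_of_nonneg_right (Finset.sum_nonneg fun x _ => hf x)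

end StateConcentration

section ScoreConcentration

variable {d n : ℕ} {β : ℝ} {E : Fin d → ℝ} {l : (Fin n → Fin d) → ℝ}
  {ρ : Matrix (Fin d) (Fin d) ℂ}

/-- The score of `x`, per copy, is within `δ` of `D`.  The condition `0 < l x` excludes the junk
value `log 0 = 0` in the score. -/
abbrev IsTypical (β : ℝ) (E : Fin d → ℝ) (l : (Fin n → Fin d) → ℝ) (D δ : ℝ) (x : Fin n → Fin d) :
    Prop :=
  0 < l x ∧ |workScore β E l x - n * D| < n * δ

theorem isTypical_relEntropy (hβ : 0 < β) (hρ : IsDensity ρ) {x : Fin n → Fin d} {δ : ℝ}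
    (hsmall : Real.exp (-(n * (eigenEntropy hρ.1.1 + 2 * δ))) < l x)
    (hlarge : l x < Real.exp (-(n * (eigenEntropy hρ.1.1 - 2 * δ))))
    (henergy : |copiesEnergy E n x - n * meanEnergy E ρ| < n * δ) :
    IsTypical β E l (relEntropy ρ (gibbs β E)) ((2 + β) * δ) x := by
  have hlx : 0 < l x := (Real.exp_pos _).trans hsmall
  have hlog_lower := (Real.lt_log_iff_exp_lt hlx).2 hsmall
  have hlog_upper := (Real.log_lt_iff_lt_exp hlx).2 hlarge
  rw [abs_lt] at henergy
  have henergy_lower := mul_lt_mul_of_pos_left henergy.1 hβ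
  have henergy_upper := mul_lt_mul_of_pos_left henergy.2 hβ
  refine ⟨hlx, ?_⟩
  rw [relEntropy_gibbs β E hρ, workScore, abs_lt]
  constructor <;> nlinarith

theorem IsUniversalBasis.sum_rotatedWeight_atypical_le
    {U : Matrix (Fin n → Fin d) (Fin n → Fin d) ℂ} (hU : IsUniversalBasis U l) (hβ : 0 < β)
    (hρ : IsDensity ρ) (E : Fin d → ℝ) {δ : ℝ} (hn : 0 < n) (hδ : 0 < δ) :
    ∑ x with ¬IsTypical β E l (relEntropy ρ (gibbs β E)) ((2 + β) * δ) x,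
        rotatedWeight U (tensorPower ρ n) x ≤
      scoreVariance E hρ / (n * δ ^ 2) +
        2 * (((n : ℝ) + 1) ^ (d * d) * Real.exp (-(n * δ))) := by
  have hweight := rotatedWeight_nonneg (posSemidef_tensorPower hρ.1 n) U
  have hsmall := hU.sum_rotatedWeight_small_le hρ hn hδ
  have hlarge := hU.sum_rotatedWeight_large_le hρ hn hδ
  have henergy := hU.sum_rotatedWeight_energy_le hρ E hn hδ
  set small : Finset (Fin n → Fin d) := {x | l x ≤ Real.exp (-(n * (eigenEntropy hρ.1.1 + 2 * δ)))}
  set large : Finset (Fin n → Fin d) := {x | Real.exp (-(n * (eigenEntropy hρ.1.1 - 2 * δ))) ≤ l x}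
  set off : Finset (Fin n → Fin d) := {x | n * δ ≤ |copiesEnergy E n x - n * meanEnergy E ρ|}
  have hcover : ({x | ¬IsTypical β E l (relEntropy ρ (gibbs β E)) ((2 + β) * δ) x} :
      Finset (Fin n → Fin d)) ⊆ small ∪ large ∪ off := by
    intro x hx
    contrapose! hx
    simp only [Finset.mem_union, not_or, small, large, off, Finset.mem_filter, Finset.mem_univ,
      true_and, not_le, not_not] at hx ⊢
    exact isTypical_relEntropy hβ hρ hx.1.1 hx.1.2 hx.2
  have hunion := (Finset.sum_le_sum_of_subset_of_nonneg hcover fun x _ _ => hweight x).trans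
    ((sum_union_le_of_nonneg hweight _ _).trans
      (add_le_add_left (sum_union_le_of_nonneg hweight _ _) _))
  refine (hunion.trans (add_le_add (add_le_add hsmall hlarge) henergy)).trans_eq ?_
  rw [scoreVariance, Fintype.card_fin]
  ring

end ScoreConcentration

section Grid

/-- The width of the cells into which the work per copy is rounded down.  The exponent is small
enough for the deviations of the score to be negligible on this scale. -/
def gridWidth (n : ℕ) : ℝ := (((n / 2 : ℕ) : ℝ) + 1) ^ (-(1 / 4) : ℝ)

/-- The position of the cells, in units of their width.  Since `2 * k` and `2 * k + 1` have cells of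
the same width, shifted by half of it, every point is away from the cell boundaries for at least one
of the two. -/
def gridOffset (n : ℕ) : ℝ := if Even n then 0 else 1 / 2

/-- The lower end of the cell containing `u`. -/
def gridFloor (n : ℕ) (u : ℝ) : ℝ :=
  gridWidth n * (⌊u / gridWidth n - gridOffset n⌋ + gridOffset n)

theorem gridWidth_pos (n : ℕ) : 0 < gridWidth n := Real.rpow_pos_of_pos (by positivity) _

theorem gridFloor_le (n : ℕ) (u : ℝ) : gridFloor n u ≤ u := by
  have hw := gridWidth_pos n
  have hfloor := Int.floor_le (u / gridWidth n - gridOffset n)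
  calc gridFloor n u ≤ gridWidth n * (u / gridWidth n) :=
        mul_le_mul_of_nonneg_left (by linarith) hw.le
    _ = u := by field_simp

theorem lt_gridFloor_add (n : ℕ) (u : ℝ) : u < gridFloor n u + gridWidth n := by
  have hw := gridWidth_pos n
  have hfloor := Int.lt_floor_add_one (u / gridWidth n - gridOffset n)
  calc u = gridWidth n * (u / gridWidth n) := by field_simp
    _ < gridWidth n * (⌊u / gridWidth n - gridOffset n⌋ + 1 + gridOffset n) :=
        mul_lt_mul_of_pos_left (by linarith) hw
    _ = gridFloor n u + gridWidth n := by rw [gridFloor]; ring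

/-- The point `D` lies in the middle half of its cell. -/
def IsCentral (n : ℕ) (D : ℝ) : Prop :=
  ∃ m : ℤ, D / gridWidth n - gridOffset n ∈ Set.Icc ((m : ℝ) + 1 / 4) (m + 3 / 4)

theorem IsCentral.gridFloor_eq {n : ℕ} {u D : ℝ} (hD : IsCentral n D)
    (hu : |u - D| < gridWidth n / 4) : gridFloor n u = gridFloor n D := by
  obtain ⟨m, hm_le, hle_m⟩ := hD
  have hw := gridWidth_pos n
  have hquot : |u / gridWidth n - D / gridWidth n| < 1 / 4 := by
    rw [← sub_div, abs_div, abs_of_pos hw, div_lt_iff₀ hw]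
    linarith
  rw [abs_lt] at hquot
  have hfloor_u : ⌊u / gridWidth n - gridOffset n⌋ = m :=
    Int.floor_eq_iff.2 ⟨by linarith, by linarith⟩
  have hfloor_D : ⌊D / gridWidth n - gridOffset n⌋ = m :=
    Int.floor_eq_iff.2 ⟨by linarith, by linarith⟩
  rw [gridFloor, gridFloor, hfloor_u, hfloor_D]

theorem isCentral_even_or_odd (D : ℝ) (k : ℕ) : IsCentral (2 * k) D ∨ IsCentral (2 * k + 1) D := by
  have hwidth : gridWidth (2 * k + 1) = gridWidth (2 * k) := by
    rw [gridWidth, gridWidth, show (2 * k + 1) / 2 = 2 * k / 2 by omega]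
  have heven : gridOffset (2 * k) = 0 := by simp [gridOffset]
  have hodd : gridOffset (2 * k + 1) = 1 / 2 := by simp [gridOffset]
  rw [IsCentral, IsCentral, hwidth, heven, hodd]
  set y := D / gridWidth (2 * k)
  have hfloor := Int.floor_le y
  have hlt_floor := Int.lt_floor_add_one y
  rcases lt_or_ge y (⌊y⌋ + 1 / 4) with hlow | hlow
  · exact Or.inr ⟨⌊y⌋ - 1, by push_cast; linarith, by push_cast; linarith⟩
  rcases lt_or_ge y (⌊y⌋ + 3 / 4) with hmid | hhigh
  · exact Or.inl ⟨⌊y⌋, by linarith, by linarith⟩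
  · exact Or.inr ⟨⌊y⌋, by linarith, by linarith⟩

theorem frequently_isCentral (D : ℝ) : ∃ᶠ n in atTop, IsCentral n D := by
  refine frequently_atTop.2 fun N => ?_
  rcases isCentral_even_or_odd D N with h | h
  · exact ⟨2 * N, by omega, h⟩
  · exact ⟨2 * N + 1, by omega, h⟩

theorem tendsto_natCast_add_one_atTop : Tendsto (fun n : ℕ => (n : ℝ) + 1) atTop atTop :=
  tendsto_atTop_add_const_right _ _ tendsto_natCast_atTop_atTop

theorem tendsto_gridWidth : Tendsto gridWidth atTop (𝓝 0) :=
  (tendsto_rpow_neg_atTop (by norm_num : (0 : ℝ) < 1 / 4)).comp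
    (tendsto_natCast_add_one_atTop.comp (Nat.tendsto_div_const_atTop two_ne_zero))

theorem le_gridWidth (n : ℕ) : ((n : ℝ) + 1) ^ (-(1 / 4) : ℝ) ≤ gridWidth n := by
  refine Real.rpow_le_rpow_of_nonpos (by positivity) ?_ (by norm_num)
  exact add_le_add_left (Nat.cast_le.2 (Nat.div_le_self n 2)) 1

theorem rpow_le_mul_gridWidth {n : ℕ} (hn : 0 < n) :
    ((n : ℝ) + 1) ^ (3 / 4 : ℝ) / 2 ≤ n * gridWidth n := by
  have hn' : (1 : ℝ) ≤ n := by exact_mod_cast hn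
  calc ((n : ℝ) + 1) ^ (3 / 4 : ℝ) / 2
      = ((n : ℝ) + 1) / 2 * ((n : ℝ) + 1) ^ (-(1 / 4) : ℝ) := by
        rw [div_mul_eq_mul_div, ← Real.rpow_one_add' (by positivity) (by norm_num)]
        norm_num
    _ ≤ n * gridWidth n := mul_le_mul (by linarith) (le_gridWidth n) (by positivity) (by positivity)

theorem rpow_le_mul_sq_gridWidth {n : ℕ} (hn : 0 < n) :
    ((n : ℝ) + 1) ^ (1 / 2 : ℝ) / 2 ≤ n * gridWidth n ^ 2 := by
  have hw := gridWidth_pos n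
  calc ((n : ℝ) + 1) ^ (1 / 2 : ℝ) / 2
      = ((n : ℝ) + 1) ^ (3 / 4 : ℝ) / 2 * ((n : ℝ) + 1) ^ (-(1 / 4) : ℝ) := by
        rw [div_mul_eq_mul_div, ← Real.rpow_add (by positivity)]
        norm_num
    _ ≤ n * gridWidth n * gridWidth n :=
        mul_le_mul (rpow_le_mul_gridWidth hn) (le_gridWidth n) (by positivity) (by positivity)
    _ = n * gridWidth n ^ 2 := by ring

theorem tendsto_div_mul_sq_gridWidth (C : ℝ) {c : ℝ} (hc : 0 < c) :
    Tendsto (fun n : ℕ => C / (n * (c * gridWidth n) ^ 2)) atTop (𝓝 0) := by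
  refine tendsto_const_nhds.div_atTop (tendsto_atTop_mono' _ ?_
    (((tendsto_rpow_atTop (by norm_num : (0 : ℝ) < 1 / 2)).comp
      tendsto_natCast_add_one_atTop).const_mul_atTop (by positivity : 0 < c ^ 2 / 2)))
  filter_upwards [eventually_gt_atTop 0] with n hn
  calc
    c ^ 2 / 2 * ((n : ℝ) + 1) ^ (1 / 2 : ℝ) = c ^ 2 * (((n : ℝ) + 1) ^ (1 / 2 : ℝ) / 2) := by ring
    _ ≤ c ^ 2 * (n * gridWidth n ^ 2) :=
        mul_le_mul_of_nonneg_left (rpow_le_mul_sq_gridWidth hn) (sq_nonneg c)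
    _ = n * (c * gridWidth n) ^ 2 := by ring

theorem tendsto_pow_mul_exp_neg_mul_gridWidth {c : ℝ} (hc : 0 < c) (k : ℕ) :
    Tendsto (fun n : ℕ => ((n : ℝ) + 1) ^ k * Real.exp (-(n * (c * gridWidth n)))) atTop
      (𝓝 0) := by
  have hlim := (tendsto_rpow_mul_exp_neg_mul_atTop_nhds_zero (4 / 3 * k) (c / 2)
    (by positivity)).comp ((tendsto_rpow_atTop (by norm_num : (0 : ℝ) < 3 / 4)).comp
      tendsto_natCast_add_one_atTop)
  refine squeeze_zero' (Eventually.of_forall fun n => by positivity) ?_ hlim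
  filter_upwards [eventually_gt_atTop 0] with n hn
  have hpow : (((n : ℝ) + 1) ^ (3 / 4 : ℝ)) ^ (4 / 3 * k : ℝ) = ((n : ℝ) + 1) ^ k := by
    rw [← Real.rpow_mul (by positivity), ← Real.rpow_natCast]
    congr 1
    ring
  have hexp := mul_le_mul_of_nonneg_left (rpow_le_mul_gridWidth hn) hc.le
  simp only [Function.comp, hpow]
  refine mul_le_mul_of_nonneg_left (Real.exp_le_exp.2 ?_) (by positivity)
  linarith

end Grid

section Assignment

variable {d n : ℕ} {β : ℝ} {E : Fin d → ℝ}

theorem sum_exp_copiesEnergy {α : Type*} [Fintype α] (β : ℝ) (E : α → ℝ) (n : ℕ) :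
    ∑ x : Fin n → α, Real.exp (-β * copiesEnergy E n x) = partitionFn β E ^ n := by
  simp only [partitionFn, tsum_fintype, Fintype.sum_pow, copiesEnergy, Finset.mul_sum,
    Real.exp_sum]

theorem exp_copiesEnergy_eq_of_pos {α : Type*} [Finite α] [Nonempty α] (β : ℝ) (E : α → ℝ)
    {l : (Fin n → α) → ℝ} {x : Fin n → α} (hl : 0 < l x) :
    Real.exp (-β * copiesEnergy E n x) =
      Real.exp (-workScore β E l x) * partitionFn β E ^ n * l x := by
  have hlogs : -β * copiesEnergy E n x =
      -workScore β E l x + n * Real.log (partitionFn β E) + Real.log (l x) := by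
    rw [workScore]
    ring
  rw [hlogs, Real.exp_add, Real.exp_add, Real.exp_log hl, Real.exp_nat_mul,
    Real.exp_log (partitionFn_pos β E)]

/-- The part of the score that is given up so that the levels of the work storage are populated
rarely enough for `workAssignment` to be implemented by a thermal operation: the logarithm of twice
the bound on the total weight of a universal basis. -/
def scoreOverhead (d n : ℕ) : ℝ := Real.log (2 * ((n : ℝ) + 1) ^ (d * d))

theorem scoreOverhead_pos (d n : ℕ) : 0 < scoreOverhead d n := by
  have hpow : (1 : ℝ) ≤ ((n : ℝ) + 1) ^ (d * d) :=
    one_le_pow₀ (le_add_of_nonneg_left n.cast_nonneg)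
  exact Real.log_pos (by linarith)

theorem exp_scoreOverhead (d n : ℕ) :
    Real.exp (scoreOverhead d n) = 2 * ((n : ℝ) + 1) ^ (d * d) :=
  Real.exp_log (by positivity)

theorem tendsto_scoreOverhead_div (d : ℕ) :
    Tendsto (fun n : ℕ => scoreOverhead d n / n) atTop (𝓝 0) := by
  have hlog := (Real.tendsto_pow_log_div_mul_add_atTop 1 (-1) 1 one_ne_zero).comp
    tendsto_natCast_add_one_atTop
  have hconst : Tendsto (fun n : ℕ => Real.log 2 / (n : ℝ)) atTop (𝓝 0) :=
    tendsto_const_nhds.div_atTop tendsto_natCast_atTop_atTop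
  have hsum := hconst.add (hlog.const_mul ((d * d : ℕ) : ℝ))
  simp only [mul_zero, add_zero] at hsum
  refine hsum.congr fun n => ?_
  simp only [Function.comp, pow_one, one_mul, add_neg_cancel_right]
  rw [scoreOverhead, Real.log_mul two_ne_zero (by positivity), Real.log_pow]
  ring

/-- The multiple `m * g` of a level `g` of the work storage, again a level. -/
def workMultiple (g : workSet E) (m : ℕ) : workSet E :=
  ⟨m * g, mul_nonneg m.cast_nonneg g.2.1, by
    obtain ⟨N, hN, hg⟩ := g.2.2
    exact ⟨fun i => m * N i, by rw [← Finset.mul_sum, hN, mul_zero], by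
      simp [hg, Finset.mul_sum, mul_assoc]⟩⟩

/-- The number of quanta `g` of work extracted at score `u` per copy. -/
def workQuanta (β : ℝ) (g : workSet E) (n : ℕ) (u : ℝ) : ℕ :=
  ⌊(n * gridFloor n u - scoreOverhead d n) / (β * g)⌋₊

/-- The work extracted on the outcome `x` of measuring a universal basis.  Rounding the score to the
grid makes nearly all outcomes yield exactly the same work. -/
def workAssignment (β : ℝ) (g : workSet E) (l : (Fin n → Fin d) → ℝ) (x : Fin n → Fin d) :
    workSet E :=
  if 0 < l x then workMultiple g (workQuanta β g n (workScore β E l x / n)) else workGround E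

theorem mul_workMultiple_workQuanta_le (hβ : 0 < β) {g : workSet E} {u : ℝ}
    (h : workMultiple g (workQuanta β g n u) ≠ workGround E) :
    β * (workMultiple g (workQuanta β g n u) : ℝ) ≤ n * gridFloor n u - scoreOverhead d n := by
  have hmul : (workQuanta β g n u : ℝ) * g ≠ 0 := fun h0 => h (Subtype.ext h0)
  have hg : 0 < (g : ℝ) := g.2.1.lt_of_ne' (right_ne_zero_of_mul hmul)
  have hquanta := (Nat.le_floor_iff' (Nat.cast_ne_zero.1 (left_ne_zero_of_mul hmul))).1
    (le_refl (workQuanta β g n u))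
  rw [le_div_iff₀ (mul_pos hβ hg)] at hquanta
  calc β * (workMultiple g (workQuanta β g n u) : ℝ) = workQuanta β g n u * (β * g) :=
        mul_left_comm _ _ _
    _ ≤ n * gridFloor n u - scoreOverhead d n := hquanta

theorem le_mul_workMultiple_workQuanta (hβ : 0 < β) {g : workSet E} (hg : 0 < (g : ℝ)) (n : ℕ)
    (u : ℝ) : n * (u - gridWidth n) - scoreOverhead d n - β * g ≤
      β * (workMultiple g (workQuanta β g n u) : ℝ) := by
  have hquanta := Nat.lt_floor_add_one ((n * gridFloor n u - scoreOverhead d n) / (β * g))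
  rw [div_lt_iff₀ (mul_pos hβ hg)] at hquanta
  have hfloor := mul_le_mul_of_nonneg_left (lt_gridFloor_add n u).le n.cast_nonneg (α := ℝ)
  calc n * (u - gridWidth n) - scoreOverhead d n - β * g ≤ workQuanta β g n u * (β * g) := by
        rw [workQuanta]
        linarith
    _ = β * (workMultiple g (workQuanta β g n u) : ℝ) := mul_left_comm _ _ _

theorem pos_of_workAssignment_ne {g : workSet E} {l : (Fin n → Fin d) → ℝ} {x : Fin n → Fin d}
    (h : workAssignment β g l x ≠ workGround E) : 0 < l x := by
  contrapose! h
  exact if_neg h.not_gt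

theorem mul_workAssignment_le (hβ : 0 < β) {g : workSet E} {l : (Fin n → Fin d) → ℝ}
    {x : Fin n → Fin d} (h : workAssignment β g l x ≠ workGround E) :
    β * (workAssignment β g l x : ℝ) ≤ workScore β E l x - scoreOverhead d n := by
  have hassign : workAssignment β g l x = _ := if_pos (pos_of_workAssignment_ne h)
  rw [hassign] at h ⊢
  have hle := mul_workMultiple_workQuanta_le hβ h
  rcases n.eq_zero_or_pos with rfl | hn
  · have hnonneg := mul_nonneg hβ.le (workAssignment β g l x).2.1
    have hoverhead := scoreOverhead_pos d 0
    rw [hassign] at hnonneg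
    rw [Nat.cast_zero, zero_mul] at hle
    linarith
  · have hfloor := mul_le_mul_of_nonneg_left (gridFloor_le n (workScore β E l x / n))
      n.cast_nonneg (α := ℝ)
    rw [mul_div_cancel₀ _ (Nat.cast_pos.2 hn).ne'] at hfloor
    linarith

theorem sum_exp_workAssignment_le [Nonempty (Fin d)] (hβ : 0 < β) (g : workSet E)
    {U : Matrix (Fin n → Fin d) (Fin n → Fin d) ℂ} {l : (Fin n → Fin d) → ℝ}
    (hU : IsUniversalBasis U l) {W : workSet E} (hW : W ≠ workGround E) :
    2 * ∑ x with workAssignment β g l x = W, Real.exp (-β * copiesEnergy E n x) ≤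
      Real.exp (-β * W) * ∑ x : Fin n → Fin d, Real.exp (-β * copiesEnergy E n x) := by
  have hZ := partitionFn_pos β E
  set c := Real.exp (-β * W - scoreOverhead d n) * partitionFn β E ^ n with hc
  have hpoint (x) (hx : workAssignment β g l x = W) :
      Real.exp (-β * copiesEnergy E n x) ≤ c * l x := by
    have hne : workAssignment β g l x ≠ workGround E := hx ▸ hW
    have hle := mul_workAssignment_le hβ hne
    rw [hx] at hle
    rw [exp_copiesEnergy_eq_of_pos β E (pos_of_workAssignment_ne hne)]
    have hl := hU.nonneg x
    rw [hc]
    gcongr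
    linarith
  have hsum : ∑ x with workAssignment β g l x = W, Real.exp (-β * copiesEnergy E n x) ≤
      c * ((n : ℝ) + 1) ^ (d * d) := by
    have htotal := hU.sum_le
    rw [Fintype.card_fin] at htotal
    calc _ ≤ ∑ x with workAssignment β g l x = W, c * l x :=
          Finset.sum_le_sum fun x hx => hpoint x (Finset.mem_filter.1 hx).2
      _ ≤ ∑ x, c * l x := Finset.sum_le_univ_sum_of_nonneg fun x =>
          mul_nonneg (by positivity) (hU.nonneg x)
      _ = c * ∑ x, l x := (Finset.mul_sum ..).symm
      _ ≤ c * ((n : ℝ) + 1) ^ (d * d) := mul_le_mul_of_nonneg_left htotal (by positivity)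
  calc _ ≤ 2 * (c * ((n : ℝ) + 1) ^ (d * d)) := mul_le_mul_of_nonneg_left hsum two_pos.le
    _ = Real.exp (-β * W) * ∑ x : Fin n → Fin d, Real.exp (-β * copiesEnergy E n x) := by
        rw [sum_exp_copiesEnergy, hc, Real.exp_sub, exp_scoreOverhead]
        field_simp

theorem exists_pos_workSet (hE : ∃ i j, E i ≠ E j) : ∃ g : workSet E, 0 < (g : ℝ) := by
  obtain ⟨i, j, hij⟩ := hE
  wlog h : E i < E j generalizing i j
  · exact this j i hij.symm (hij.lt_or_gt.resolve_left h)
  refine ⟨⟨E j - E i, sub_nonneg.2 h.le, Pi.single j 1 - Pi.single i 1, ?_, ?_⟩, sub_pos.2 h⟩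
  · simp [Finset.sum_sub_distrib]
  · simp [sub_mul, Finset.sum_sub_distrib, Pi.single_apply]

theorem relEntropy_gibbs_of_dim_one (β : ℝ) (E : Fin 1 → ℝ) {ρ : Matrix (Fin 1) (Fin 1) ℂ}
    (hρ : IsDensity ρ) : relEntropy ρ (gibbs β E) = 0 := by
  have heigenvalue := hρ.sum_eigenvalues
  have hentry := hρ.sum_re_apply_self
  simp only [Finset.univ_unique, Fin.default_eq_zero, Finset.sum_singleton] at heigenvalue hentry
  rw [relEntropy_gibbs β E hρ]
  simp [meanEnergy, eigenEntropy, partitionFn, heigenvalue, hentry]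

end Assignment

section Existence

variable {d n : ℕ} {β : ℝ} {E : Fin d → ℝ}

theorem exists_isThermalOperation_workAssignment [Nonempty (Fin d)] (hβ : 0 < β) (g : workSet E)
    {U : Matrix (Fin n → Fin d) (Fin n → Fin d) ℂ} {l : (Fin n → Fin d) → ℝ}
    (hU : IsUniversalBasis U l) {η : ℝ} (hη : 0 < η) :
    ∃ Λ, IsThermalOperation β (addEnergy (copiesEnergy E n) (workEnergy E)) (workEnergy E) Λ ∧
      ImplementsAssignment Λ U (workAssignment β g l) (workGround E) η := by
  have hconserves : ConservesEnergy (copiesEnergy E n) U := conservesEnergy_iff.2 fun x y hxy => by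
    rw [copiesEnergy_eq_occEnergy, copiesEnergy_eq_occEnergy, hU.seqType_eq x y hxy]
  choose N _ hN using fun W : workSet E => W.2.2
  exact exists_isThermalOperation_implementsAssignment (copiesEnergy_eq_occEnergy E) hN
    (isUnitary_of_mem_unitaryGroup hU.unitary) hconserves rfl _
    (fun W hW => sum_exp_workAssignment_le hβ g hU hW) hη

end Existence

section ExtractedWork

variable {d n : ℕ} {E : Fin d → ℝ} {ρ : Matrix (Fin d) (Fin d) ℂ} {ε z : ℝ}
  {Λ : Matrix ((Fin n → Fin d) × workSet E) ((Fin n → Fin d) × workSet E) ℂ →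
    Matrix (workSet E) (workSet E) ℂ}

theorem extractedWork_div_le (hn : 0 < n)
    (h : ∀ W : workSet E,
      1 - ε ≤ fidelityBasis (Λ (tensorPower ρ n ⊗ₖ basisProj (workGround E))) W →
        (W : ℝ) ≤ n * z) :
    extractedWork E n Λ ρ ε / n ≤ z := by
  rw [EReal.div_le_iff_le_mul (by exact_mod_cast hn) (EReal.natCast_ne_top n)]
  refine sSup_le ?_
  rintro _ ⟨W, rfl, hW⟩
  exact_mod_cast h W hW

theorem le_extractedWork_div (hn : 0 < n) {W : workSet E} (hz : n * z ≤ W)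
    (hW : 1 - ε ≤ fidelityBasis (Λ (tensorPower ρ n ⊗ₖ basisProj (workGround E))) W) :
    (z : EReal) ≤ extractedWork E n Λ ρ ε / n := by
  rw [EReal.le_div_iff_mul_le (by exact_mod_cast hn) (EReal.natCast_ne_top n), mul_comm]
  exact le_sSup_of_le ⟨W, rfl, hW⟩ (by exact_mod_cast hz)

end ExtractedWork

section AtypicalWeight

variable {d n : ℕ} {β : ℝ} {E : Fin d → ℝ} {ρ : Matrix (Fin d) (Fin d) ℂ}

/-- The probability, when a universal basis is measured on `ρ^{⊗ n}`, that the score per copy is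
further than a quarter of the grid width from the relative entropy to the Gibbs state. -/
def atypicalWeight (β : ℝ) (E : Fin d → ℝ) (ρ : Matrix (Fin d) (Fin d) ℂ)
    (U : Matrix (Fin n → Fin d) (Fin n → Fin d) ℂ) (l : (Fin n → Fin d) → ℝ) : ℝ :=
  ∑ x with ¬IsTypical β E l (relEntropy ρ (gibbs β E)) (gridWidth n / 4) x,
    rotatedWeight U (tensorPower ρ n) x

theorem atypicalWeight_nonneg (hρ : ρ.PosSemidef)
    (U : Matrix (Fin n → Fin d) (Fin n → Fin d) ℂ) (l : (Fin n → Fin d) → ℝ) :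
    0 ≤ atypicalWeight β E ρ U l :=
  Finset.sum_nonneg fun x _ => rotatedWeight_nonneg (posSemidef_tensorPower hρ n) U x

theorem tendsto_atypicalWeight (hβ : 0 < β) (E : Fin d → ℝ) (hρ : IsDensity ρ)
    {U : ∀ n : ℕ, Matrix (Fin n → Fin d) (Fin n → Fin d) ℂ} {l : ∀ n : ℕ, (Fin n → Fin d) → ℝ}
    (hU : ∀ n, IsUniversalBasis (U n) (l n)) :
    Tendsto (fun n => atypicalWeight β E ρ (U n) (l n)) atTop (𝓝 0) := by
  have hc : 0 < 1 / (4 * (2 + β)) := by positivity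
  have hbound := (tendsto_div_mul_sq_gridWidth (scoreVariance E hρ) hc).add
    ((tendsto_pow_mul_exp_neg_mul_gridWidth hc (d * d)).const_mul 2)
  rw [mul_zero, add_zero] at hbound
  refine squeeze_zero' (Eventually.of_forall fun n => atypicalWeight_nonneg hρ.1 _ _) ?_ hbound
  filter_upwards [eventually_gt_atTop 0] with n hn
  have hδ : (2 + β) * (1 / (4 * (2 + β)) * gridWidth n) = gridWidth n / 4 := by field_simp
  rw [atypicalWeight, ← hδ]
  exact (hU n).sum_rotatedWeight_atypical_le hβ hρ E hn (mul_pos hc (gridWidth_pos n))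

variable {g : workSet E} {U : Matrix (Fin n → Fin d) (Fin n → Fin d) ℂ} {l : (Fin n → Fin d) → ℝ}
  {Λ : Matrix ((Fin n → Fin d) × workSet E) ((Fin n → Fin d) × workSet E) ℂ →
    Matrix (workSet E) (workSet E) ℂ} {η : ℝ}

theorem workAssignment_eq_of_isTypical {D : ℝ} (hD : IsCentral n D) {x : Fin n → Fin d}
    (hx : IsTypical β E l D (gridWidth n / 4) x) :
    workAssignment β g l x = workMultiple g (workQuanta β g n D) := by
  have hn : (0 : ℝ) < n := pos_of_mul_pos_left ((abs_nonneg _).trans_lt hx.2)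
    (div_pos (gridWidth_pos n) four_pos).le
  have hscore : |workScore β E l x / n - D| < gridWidth n / 4 := by
    rw [div_sub' hn.ne', abs_div, abs_of_pos hn, div_lt_iff₀' hn]
    exact hx.2
  rw [workAssignment, if_pos hx.1, workQuanta, workQuanta, hD.gridFloor_eq hscore]

theorem mul_le_of_atypicalWeight_lt (hβ : 0 < β) (hρ : IsDensity ρ)
    (hΛ : ImplementsAssignment Λ U (workAssignment β g l) (workGround E) η) {W : workSet E}
    (hW : atypicalWeight β E ρ U l <
      fidelityBasis (Λ (tensorPower ρ n ⊗ₖ basisProj (workGround E))) W) :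
    β * W ≤ n * (relEntropy ρ (gibbs β E) + gridWidth n) := by
  have hw := gridWidth_pos n
  have hD := relEntropy_gibbs_nonneg β E hρ
  have hpsd := posSemidef_tensorPower hρ.1 n
  by_cases hground : W = workGround E
  · rw [hground, workGround, mul_zero]
    positivity
  obtain ⟨x, hxW, hx⟩ : ∃ x, workAssignment β g l x = W ∧
      IsTypical β E l (relEntropy ρ (gibbs β E)) (gridWidth n / 4) x := by
    by_contra! hatypical
    refine hW.not_ge (((hΛ _ hpsd W).2 hground).trans ?_)
    exact Finset.sum_le_sum_of_subset_of_nonneg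
      (Finset.monotone_filter_right _ fun x _ hxW => hatypical x hxW)
      fun x _ _ => rotatedWeight_nonneg hpsd U x
  have hassign := mul_workAssignment_le hβ (g := g) (l := l) (x := x) (hxW ▸ hground)
  rw [hxW] at hassign
  have hscore := (abs_lt.1 hx.2).2
  have hoverhead := scoreOverhead_pos d n
  have hquarter : (n : ℝ) * (gridWidth n / 4) ≤ n * gridWidth n :=
    mul_le_mul_of_nonneg_left (by linarith) n.cast_nonneg
  linarith

theorem mul_one_sub_atypicalWeight_le (hρ : IsDensity ρ) (hU : U ∈ Matrix.unitaryGroup _ ℂ)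
    (hΛ : ImplementsAssignment Λ U (workAssignment β g l) (workGround E) η) (hη : η ≤ 1)
    (hD : IsCentral n (relEntropy ρ (gibbs β E))) :
    (1 - η) * (1 - atypicalWeight β E ρ U l) ≤
      fidelityBasis (Λ (tensorPower ρ n ⊗ₖ basisProj (workGround E)))
        (workMultiple g (workQuanta β g n (relEntropy ρ (gibbs β E)))) := by
  have hpsd := posSemidef_tensorPower hρ.1 n
  refine (mul_le_mul_of_nonneg_left ?_ (sub_nonneg.2 hη)).trans (hΛ _ hpsd _).1
  rw [← hρ.sum_rotatedWeight_tensorPower hU, atypicalWeight, sub_le_iff_le_add,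
    ← Finset.sum_filter_add_sum_filter_not _
      (IsTypical β E l (relEntropy ρ (gibbs β E)) (gridWidth n / 4))]
  refine add_le_add_left ?_ _
  exact Finset.sum_le_sum_of_subset_of_nonneg
    (Finset.monotone_filter_right _ fun x _ hx => workAssignment_eq_of_isTypical hD hx)
    fun x _ _ => rotatedWeight_nonneg hpsd U x

end AtypicalWeight

section Rate

variable {d : ℕ} {β : ℝ} {E : Fin d → ℝ} {g : workSet E} {ρ : Matrix (Fin d) (Fin d) ℂ} {ε : ℝ}
  {U : ∀ n : ℕ, Matrix (Fin n → Fin d) (Fin n → Fin d) ℂ} {l : ∀ n : ℕ, (Fin n → Fin d) → ℝ}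
  {Λ : ∀ n : ℕ, Matrix ((Fin n → Fin d) × workSet E) ((Fin n → Fin d) × workSet E) ℂ →
    Matrix (workSet E) (workSet E) ℂ} {η : ℕ → ℝ}

theorem limsup_extractedWork_le (hβ : 0 < β) (hU : ∀ n, IsUniversalBasis (U n) (l n))
    (hρ : IsDensity ρ)
    (hΛ : ∀ n, ImplementsAssignment (Λ n) (U n) (workAssignment β g (l n)) (workGround E) (η n))
    (hε : ε < 1) :
    limsup (fun n : ℕ => extractedWork E n (Λ n) ρ ε / (n : EReal)) atTop ≤
      ((relEntropy ρ (gibbs β E) / β : ℝ) : EReal) := by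
  rw [← EReal.le_of_forall_lt_iff_le]
  intro z hz
  have hz' : relEntropy ρ (gibbs β E) < z * β := (div_lt_iff₀ hβ).1 (EReal.coe_lt_coe_iff.1 hz)
  refine limsup_le_of_le (by isBoundedDefault) ?_
  filter_upwards [(tendsto_atypicalWeight hβ E hρ hU).eventually_lt_const (sub_pos.2 hε),
    tendsto_gridWidth.eventually_lt_const (sub_pos.2 hz'), eventually_gt_atTop 0]
    with n hatypical hwidth hn
  refine extractedWork_div_le hn fun W hW => le_of_mul_le_mul_left ?_ hβ
  calc β * W ≤ n * (relEntropy ρ (gibbs β E) + gridWidth n) :=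
        mul_le_of_atypicalWeight_lt hβ hρ (hΛ n) (hatypical.trans_le hW)
    _ ≤ n * (z * β) := mul_le_mul_of_nonneg_left (by linarith) n.cast_nonneg
    _ = β * (n * z) := by ring

theorem eventually_le_workMultiple_workQuanta (hβ : 0 < β) (hg : 0 < (g : ℝ)) {D z : ℝ}
    (hz : z < D / β) :
    ∀ᶠ n : ℕ in atTop, n * z ≤ (workMultiple g (workQuanta β g n D) : ℝ) := by
  have hrate : Tendsto (fun n : ℕ => D - gridWidth n - scoreOverhead d n / n - β * g / n) atTop
      (𝓝 D) := by
    simpa using ((tendsto_const_nhds.sub tendsto_gridWidth).sub (tendsto_scoreOverhead_div d)).sub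
      (tendsto_const_nhds.div_atTop (a := β * (g : ℝ)) tendsto_natCast_atTop_atTop)
  filter_upwards [hrate.eventually_const_lt ((lt_div_iff₀ hβ).1 hz), eventually_gt_atTop 0]
    with n hlt hn
  have hn' : (0 : ℝ) < n := Nat.cast_pos.2 hn
  refine le_of_mul_le_mul_left ?_ hβ
  calc β * (n * z) = n * (z * β) := by ring
    _ ≤ n * (D - gridWidth n - scoreOverhead d n / n - β * g / n) :=
        mul_le_mul_of_nonneg_left hlt.le hn'.le
    _ = n * (D - gridWidth n) - scoreOverhead d n - β * g := by field_simp
    _ ≤ β * (workMultiple g (workQuanta β g n D) : ℝ) :=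
        le_mul_workMultiple_workQuanta hβ hg n D

theorem eventually_le_workMultiple_relEntropy (hβ : 0 < β) (hg : d = 1 ∨ 0 < (g : ℝ))
    (hρ : IsDensity ρ) {z : ℝ} (hz : z < relEntropy ρ (gibbs β E) / β) :
    ∀ᶠ n : ℕ in atTop,
      n * z ≤ (workMultiple g (workQuanta β g n (relEntropy ρ (gibbs β E))) : ℝ) := by
  rcases hg with rfl | hg
  · rw [relEntropy_gibbs_of_dim_one β E hρ, zero_div] at hz
    exact Eventually.of_forall fun n =>
      (mul_nonpos_of_nonneg_of_nonpos n.cast_nonneg hz.le).trans (workMultiple g _).2.1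
  · exact eventually_le_workMultiple_workQuanta hβ hg hz

theorem le_limsup_extractedWork (hβ : 0 < β) (hg : d = 1 ∨ 0 < (g : ℝ))
    (hU : ∀ n, IsUniversalBasis (U n) (l n)) (hρ : IsDensity ρ)
    (hΛ : ∀ n, ImplementsAssignment (Λ n) (U n) (workAssignment β g (l n)) (workGround E) (η n))
    (hη : Tendsto η atTop (𝓝 0)) (hε : 0 < ε) :
    ((relEntropy ρ (gibbs β E) / β : ℝ) : EReal) ≤
      limsup (fun n : ℕ => extractedWork E n (Λ n) ρ ε / (n : EReal)) atTop := by
  rw [← EReal.ge_of_forall_gt_iff_ge]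
  intro z hz
  have hfidelity : Tendsto (fun n => (1 - η n) * (1 - atypicalWeight β E ρ (U n) (l n))) atTop
      (𝓝 1) := by
    simpa using (hη.const_sub 1).mul ((tendsto_atypicalWeight hβ E hρ hU).const_sub 1)
  have hcentral := frequently_isCentral (relEntropy ρ (gibbs β E))
  refine le_limsup_of_frequently_le' ((hcentral.and_eventually
    ((hfidelity.eventually_const_lt (sub_lt_self 1 hε)).and
      ((hη.eventually_le_const one_pos).and
        ((eventually_le_workMultiple_relEntropy hβ hg hρ (EReal.coe_lt_coe_iff.1 hz)).and
          (eventually_gt_atTop 0))))).mono ?_)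
  rintro n ⟨hcentral, hlt, hη1, hwork, hn⟩
  exact le_extractedWork_div hn hwork
    (hlt.le.trans (mul_one_sub_atypicalWeight_le hρ (hU n).unitary (hΛ n) hη1 hcentral))

theorem hasWorkRate_of_implementsAssignment (hβ : 0 < β) (hg : d = 1 ∨ 0 < (g : ℝ))
    (hU : ∀ n, IsUniversalBasis (U n) (l n)) (hρ : IsDensity ρ)
    (hΛ : ∀ n, ImplementsAssignment (Λ n) (U n) (workAssignment β g (l n)) (workGround E) (η n))
    (hη : Tendsto η atTop (𝓝 0)) :
    HasWorkRate E Λ ρ (relEntropy ρ (gibbs β E) / β) := by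
  refine tendsto_const_nhds.congr' ?_
  filter_upwards [Ioo_mem_nhdsGT one_pos] with ε hε
  exact (le_limsup_extractedWork hβ hg hU hρ hΛ hη hε.1).antisymm
    (limsup_extractedWork_le hβ hU hρ hΛ hε.2)

end Rate

end Thermo

end

theorem theorem1 {d : ℕ} (β : ℝ) (hβ : 0 < β) (E : Fin d → ℝ)
    (hE : d = 1 ∨ ∃ i j, E i ≠ E j) :
    ∃ R : Matrix (Fin d) (Fin d) ℂ → ℝ,
      Thermo.IsAchievableAgnosticRate β E {ρ | Thermo.IsDensity ρ} R ∧
      ∀ ρ, Thermo.IsDensity ρ → β * R ρ = Thermo.relEntropy ρ (Thermo.gibbs β E) := by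
  have : Nonempty (Fin d) := by
    rcases hE with rfl | ⟨i, -⟩
    exacts [inferInstance, ⟨i⟩]
  obtain ⟨g, hg⟩ : ∃ g : Thermo.workSet E, d = 1 ∨ 0 < (g : ℝ) := by
    rcases hE with hd | hE
    · exact ⟨Thermo.workGround E, Or.inl hd⟩
    · exact (Thermo.exists_pos_workSet hE).imp fun _ => Or.inr
  choose U l hU using Thermo.exists_isUniversalBasis (Fin d)
  choose Λ hΛ hΛU using fun n : ℕ =>
    Thermo.exists_isThermalOperation_workAssignment hβ g (hU n)
      (Nat.one_div_pos_of_nat (α := ℝ) (n := n))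
  exact ⟨fun ρ => Thermo.relEntropy ρ (Thermo.gibbs β E) / β,
    ⟨Λ, hΛ, fun ρ hρ => Thermo.hasWorkRate_of_implementsAssignment hβ hg hU hρ hΛU
      tendsto_one_div_add_atTop_nhds_zero_nat⟩,
    fun ρ _ => mul_div_cancel₀ _ hβ.ne'⟩
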